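/- Let $\Gamma$ be a primitive strongly regular graph with parameters $(v,k,\lambda,\mu)$, that is, a finite simple $k$-regular graph on $v$ vertices that is not complete, in which any two adjacent vertices have exactly $\lambda$ common neighbours and any two distinct non-adjacent vertices have exactly $\mu$ common neighbours, and such that both $\Gamma$ and its complement are connected. Assume that the smallest eigenvalue of the adjacency matrix of $\Gamma$ is $-m$, where $m$ is a positive integer, and put $$f(m,\mu)=\tfrac{8}{3}m(\mu-1)-\tfrac{2}{3}\mu+3m-\tfrac{10}{3}.$$ Then the following hold. (i) If $\mu=m(m-1)$ and $\lambda>f(m,\mu)$, then $\Gamma$ is the collinearity graph of a partial geometry $\mathrm{pg}(K,R,T)$ with $T=R-1$, and $\Gamma$ is a Latin square graph $\mathrm{LS}_m(\lambda-m(m-3))$. (ii) If $\mu=m^2$ and $\lambda>f(m,\mu)$, then $\Gamma$ is the collinearity graph of a partial geometry $\mathrm{pg}(K,R,T)$ with $T=R$, and $\Gamma$ is the block graph of a $2$-$(\lambda(m-1)-m(m-1)(m-2)+m,\,m,\,1)$ design. (iii) If $\mu\ne m(m-1)$ and $\mu\neq m^2$, then $\lambda\le f(m,\mu)$. Here a partial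 geometry $\mathrm{pg}(K,R,T)$, with $K,R>1$ and $T>0$, is an incidence structure of points and lines (both sets non-empty) in which two distinct points are on at most one common line, every line has exactly $K$ points, every point is on exactly $R$ lines, and for each line $L$ and each point $x\notin L$ exactly $T$ lines through $x$ meet $L$. Its collinearity graph has the points as vertices, distinct points being adjacent when they are on a common line. A Latin square graph $\mathrm{LS}_m(n)$ has as vertices the $n^2$ columns of an orthogonal array $\mathrm{OA}(m,n)$ (an $m\times n^2$ array with entries from an $n$-element set in which the $n^2$ ordered pairs formed by any two distinct rows are distinct), distinct columns being adjacent when they agree in some row. A $2$-$(w,m,1)$ design consists of $w$ points and a family of blocks of $m$ points each, $2\le m\le w$, such that any two distinct points are in exactly one block; its block graph has the blocks as vertices, distinct blocks being adjacent when they share a point. -/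

import Mathlib

namespace SRGBound

universe u

/-- A primitive strongly regular graph with parameters `(v, k, l, μ)`: a strongly regular graph
that is not complete, is connected, and has a connected complement. -/
structure IsPrimitiveSRG {V : Type u} [Fintype V] (G : SimpleGraph V) [DecidableRel G.Adj]
    (v k l μ : ℕ) : Prop where
  isSRGWith : G.IsSRGWith v k l μ
  ne_top : G ≠ ⊤
  connected : G.Connected
  compl_connected : Gᶜ.Connected

/-- `t` is the smallest eigenvalue of the adjacency matrix of `G`. -/
def IsSmallestEigenvalue {V : Type u} [Fintype V] [DecidableEq V] (G : SimpleGraph V)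
    [DecidableRel G.Adj] (t : ℝ) : Prop :=
  IsLeast {x : ℝ | Module.End.HasEigenvalue (Matrix.toLin' (G.adjMatrix ℝ)) x} t

/-- The incidence structure with point set `P`, line set `L` and incidence relation `I` is a
partial geometry `pg(K, R, T)`: a partial linear space with `K` points on each line, `R` lines on
each point and, for each line `a` and each point `p` not on `a`, exactly `T` lines through `p` that
meet `a`. As usual, `K, R > 1` and `T > 0`. -/
structure IsPartialGeometry {P L : Type u} (I : P → L → Prop) (K R T : ℕ) : Prop where
  one_lt_K : 1 < K
  one_lt_R : 1 < R
  T_pos : 0 < T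
  nonempty_points : Nonempty P
  nonempty_lines : Nonempty L
  line_unique : ∀ p q : P, p ≠ q → ∀ a b : L, I p a → I q a → I p b → I q b → a = b
  order_line : ∀ a : L, {p : P | I p a}.ncard = K
  order_point : ∀ p : P, {a : L | I p a}.ncard = R
  meeting : ∀ (a : L) (p : P), ¬ I p a → {b : L | I p b ∧ ∃ q : P, I q b ∧ I q a}.ncard = T

/-- The point graph (collinearity graph) of an incidence structure: distinct points are adjacent
when they lie on a common line. -/
def pointGraph {P L : Type u} (I : P → L → Prop) : SimpleGraph P where
  Adj p q := p ≠ q ∧ ∃ a : L, I p a ∧ I q a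
  symm := ⟨fun _ _ h => ⟨h.1.symm, h.2.imp fun _ ha => ⟨ha.2, ha.1⟩⟩⟩
  loopless := ⟨fun _ h => h.1 rfl⟩

/-- `G` is (isomorphic to) the collinearity graph of a partial geometry `pg(K, R, T)`. -/
def IsCollinearityGraph {V : Type u} (G : SimpleGraph V) (K R T : ℕ) : Prop :=
  ∃ (P L : Type u) (I : P → L → Prop),
    IsPartialGeometry I K R T ∧ Nonempty (G ≃g pointGraph I)

/-- An orthogonal array `OA(m, n)`: an `m × n²` array with entries from an `n`-element set such
that the `n²` ordered pairs formed by any two distinct rows are distinct. -/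
def IsOrthogonalArray {m n : ℕ} (A : Fin m → Fin (n ^ 2) → Fin n) : Prop :=
  ∀ i j : Fin m, i ≠ j → Function.Injective fun c => (A i c, A j c)

/-- The graph on the columns of an array in which distinct columns are adjacent when they agree in
some row. -/
def columnGraph {m n : ℕ} (A : Fin m → Fin (n ^ 2) → Fin n) : SimpleGraph (Fin (n ^ 2)) where
  Adj c d := c ≠ d ∧ ∃ i : Fin m, A i c = A i d
  symm := ⟨fun _ _ h => ⟨h.1.symm, h.2.imp fun _ hi => hi.symm⟩⟩
  loopless := ⟨fun _ h => h.1 rfl⟩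

/-- `G` is a Latin square graph `LS_m(n)`: the column graph of an orthogonal array `OA(m, n)`. -/
def IsLatinSquareGraph {V : Type u} (G : SimpleGraph V) (m n : ℕ) : Prop :=
  ∃ A : Fin m → Fin (n ^ 2) → Fin n, IsOrthogonalArray A ∧ Nonempty (G ≃g columnGraph A)

/-- The incidence structure with point set `P`, block set `B` and incidence relation `I` is a
`2-(v, k, l)` design: there are `v` points, each block has `k` points, where `2 ≤ k ≤ v`, and any
two distinct points are on exactly `l` common blocks. -/
structure IsTwoDesign {P B : Type u} (I : P → B → Prop) (v k l : ℕ) : Prop where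
  two_le : 2 ≤ k
  le_card : k ≤ v
  card_points : Nat.card P = v
  card_block : ∀ b : B, {p : P | I p b}.ncard = k
  balanced : ∀ p q : P, p ≠ q → {b : B | I p b ∧ I q b}.ncard = l

/-- The block graph of an incidence structure: distinct blocks are adjacent when they share a
point. -/
def blockGraph {P B : Type u} (I : P → B → Prop) : SimpleGraph B where
  Adj b c := b ≠ c ∧ ∃ p : P, I p b ∧ I p c
  symm := ⟨fun _ _ h => ⟨h.1.symm, h.2.imp fun _ hp => ⟨hp.2, hp.1⟩⟩⟩
  loopless := ⟨fun _ h => h.1 rfl⟩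

/-- `G` is (isomorphic to) the block graph of a `2-(v, k, l)` design. -/
def IsBlockGraph {V : Type u} (G : SimpleGraph V) (v k l : ℕ) : Prop :=
  ∃ (P B : Type u) (I : P → B → Prop), IsTwoDesign I v k l ∧ Nonempty (G ≃g blockGraph I)

/-- The bound `f(m, μ) = (8/3) m (μ - 1) - (2/3) μ + 3 m - 10/3`. -/
noncomputable def f (m μ : ℕ) : ℝ :=
  8 / 3 * (m : ℝ) * ((μ : ℝ) - 1) - 2 / 3 * (μ : ℝ) + 3 * (m : ℝ) - 10 / 3

end SRGBound

/-!
When `λ > f(m, μ)`, counting the neighbours of its centre shows that a claw has at most `⌊4m/3⌋`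
leaves, and Metsch's refinement of the Bruck–Bose argument then makes the large maximal cliques into
lines: every edge is in exactly one line, and every vertex is on at most `⌊4m/3⌋` of them.

By the Delsarte bound every vertex is on at least `m` lines. Let `U` be the set of vertices on more
than `m` lines. As `A + m` is positive semidefinite, no nonzero vector supported on `U` has zero sum
on every line, so `|U|` is at most the number of lines. A crude bound on that number gives a vertex
outside `U`, hence `m ∣ μ`, and with `μ ≥ m` the lines are so large that there are at most `v / m`
of them. A vertex of `U` has at least `2k / m` neighbours in `U`, and then the projection onto the
eigenspace of `-m` takes a negative value on the characteristic vector of `U`, unless `U` is empty.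
Hence every vertex is on exactly `m` lines, all lines attain the Delsarte bound, and the vertices
and lines form a partial geometry `pg(K, m, T)` with `m T = μ`.

If `T ≤ m - 2`, the Krein condition (when `2T < m`) and the absolute bound (when `2T ≥ m`) for the
graph of the dual geometry give `K ≤ 2 m² T`, which contradicts `λ > f(m, μ)`. In the remaining
cases, `T = m - 1` makes parallelism of lines an equivalence relation, whose classes are the rows of
an orthogonal array, and `T = m` makes any two lines meet, so that the dual is a `2`-design.
-/

namespace SRGBound

open Finset

section Claws

theorem sum_card_le_card_biUnion_add {ι α : Type*} [DecidableEq α] {X : ℕ}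
    (P : ι → Finset α) (I : Finset ι)
    (hP : ∀ i ∈ I, ∀ j ∈ I, i ≠ j → #(P i ∩ P j) ≤ X) :
    ∑ i ∈ I, #(P i) ≤ #(I.biUnion P) + (#I).choose 2 * X := by
  classical
  induction I using Finset.induction_on with
  | empty => simp
  | insert i J hi ih =>
    have hJ := ih fun a ha b hb => hP a (mem_insert_of_mem ha) b (mem_insert_of_mem hb)
    have hinter : #(P i ∩ J.biUnion P) ≤ #J * X := by
      rw [inter_biUnion]
      exact card_biUnion_le_card_mul _ _ _ fun j hj =>
        hP i (mem_insert_self i J) j (mem_insert_of_mem hj) (ne_of_mem_of_not_mem hj hi).symm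
    have hunion := card_union_add_card_inter (P i) (J.biUnion P)
    rw [sum_insert hi, biUnion_insert, card_insert_of_notMem hi, Nat.choose_succ_succ' _ 1,
      Nat.choose_one_right, one_add_one_eq_two, add_mul]
    omega

variable {V : Type*} {G : SimpleGraph V} {x : V}

/-- A claw with centre `x` and set of leaves `I`: the leaves are pairwise non-adjacent neighbours
of `x`. -/
structure IsClaw (G : SimpleGraph V) (x : V) (I : Finset V) : Prop where
  adj : ∀ y ∈ I, G.Adj x y
  isIndepSet : G.IsIndepSet I

/-- A clique that is maximal with respect to inclusion. -/
def IsMaxClique (G : SimpleGraph V) (c : Finset V) : Prop :=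
  Maximal (fun d : Finset V => G.IsClique d) c

theorem IsMaxClique.adj {c : Finset V} (hc : IsMaxClique G c) {y z : V} (hy : y ∈ c) (hz : z ∈ c)
    (hyz : y ≠ z) : G.Adj y z :=
  hc.prop hy hz hyz

theorem isClaw_empty : IsClaw G x ∅ :=
  ⟨by simp, by simp⟩

theorem IsClaw.subset {I J : Finset V} (hI : IsClaw G x I) (hJ : J ⊆ I) : IsClaw G x J where
  adj := fun z hz => hI.adj z (hJ hz)
  isIndepSet := hI.isIndepSet.mono (coe_subset.2 hJ)

theorem IsClaw.not_adj {I : Finset V} (hI : IsClaw G x I) {y z : V} (hy : y ∈ I) (hz : z ∈ I) :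
    ¬ G.Adj y z :=
  fun h => hI.isIndepSet hy hz h.ne h

theorem IsMaxClique.exists_not_adj {c : Finset V} (hc : IsMaxClique G c) {z : V} (hz : z ∉ c) :
    ∃ w ∈ c, ¬ G.Adj z w := by
  classical
  by_contra! h
  refine hz (hc.le_of_ge ?_ (subset_insert z c) (mem_insert_self z c))
  rw [coe_insert]
  exact hc.prop.insert fun w hw _ => h w hw

theorem IsMaxClique.nonempty [Nonempty V] {c : Finset V} (hc : IsMaxClique G c) : c.Nonempty := by
  obtain ⟨x⟩ := ‹Nonempty V›
  by_cases hx : x ∈ c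
  · exact ⟨x, hx⟩
  · obtain ⟨w, hw, -⟩ := hc.exists_not_adj hx
    exact ⟨w, hw⟩

theorem exists_isMaxClique_superset [Finite V] {c : Finset V} (hc : G.IsClique c) :
    ∃ d, IsMaxClique G d ∧ c ⊆ d := by
  obtain ⟨d, hcd, hd⟩ :=
    (Set.toFinite {d : Finset V | G.IsClique d}).exists_le_maximal (a := c) hc
  exact ⟨d, hd, hcd⟩

variable [DecidableEq V]

theorem IsClaw.insert_of_adj {I : Finset V} (hI : IsClaw G x I) {y : V} (hy : G.Adj x y)
    (h : ∀ z ∈ I, ¬ G.Adj y z) : IsClaw G x (insert y I) where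
  adj := by simpa [hy] using hI.adj
  isIndepSet := by
    rw [coe_insert]
    exact hI.isIndepSet.insert fun z hz _ => ⟨h z hz, fun h' => h z hz h'.symm⟩

variable [Fintype V] [DecidableRel G.Adj] {ℓ X s : ℕ}

theorem card_neighborFinset_inter_inter_le
    (hμ : ∀ x y, x ≠ y → ¬ G.Adj x y → #(G.neighborFinset x ∩ G.neighborFinset y) ≤ X + 1)
    {y z : V} (hy : G.Adj x y) (hz : G.Adj x z) (hyz : y ≠ z) (h : ¬ G.Adj y z) :
    #(G.neighborFinset x ∩ (G.neighborFinset y ∩ G.neighborFinset z)) ≤ X := by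
  have hsub : G.neighborFinset x ∩ (G.neighborFinset y ∩ G.neighborFinset z) ⊆
      (G.neighborFinset y ∩ G.neighborFinset z).erase x :=
    fun w hw => mem_erase.2 ⟨by rintro rfl; simp at hw, (mem_inter.1 hw).2⟩
  have hx : x ∈ G.neighborFinset y ∩ G.neighborFinset z := by simp [hy.symm, hz.symm]
  have hcard := card_le_card hsub
  rw [card_erase_of_mem hx] at hcard
  have := hμ y z hyz h
  omega

theorem IsClaw.card_mul_le {k : ℕ} (hk : #(G.neighborFinset x) ≤ k)
    (hl : ∀ x y, G.Adj x y → #(G.neighborFinset x ∩ G.neighborFinset y) = ℓ)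
    (hμ : ∀ x y, x ≠ y → ¬ G.Adj x y → #(G.neighborFinset x ∩ G.neighborFinset y) ≤ X + 1)
    {I : Finset V} (hI : IsClaw G x I) :
    #I * (ℓ + 1) ≤ k + (#I).choose 2 * X := by
  let P : V → Finset V := fun y => insert y (G.neighborFinset x ∩ G.neighborFinset y)
  have hPcard : ∀ y ∈ I, #(P y) = ℓ + 1 := fun y hy => by
    rw [card_insert_of_notMem (by simp), hl x y (hI.adj y hy)]
  have hPinter : ∀ y ∈ I, ∀ z ∈ I, y ≠ z → #(P y ∩ P z) ≤ X := by
    intro y hy z hz hyz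
    refine (card_le_card fun w hw => ?_).trans (card_neighborFinset_inter_inter_le hμ
      (hI.adj y hy) (hI.adj z hz) hyz (hI.not_adj hy hz))
    have := hI.not_adj hy hz
    simp only [P, mem_inter, mem_insert, SimpleGraph.mem_neighborFinset] at hw ⊢
    grind [SimpleGraph.adj_comm]
  have hPunion : #(I.biUnion P) ≤ k := by
    refine (card_le_card (biUnion_subset.2 fun y hy => ?_)).trans hk
    exact insert_subset (by simpa using hI.adj y hy) inter_subset_left
  calc #I * (ℓ + 1) = ∑ y ∈ I, #(P y) := by rw [sum_congr rfl hPcard, sum_const, smul_eq_mul]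
    _ ≤ #(I.biUnion P) + (#I).choose 2 * X := sum_card_le_card_biUnion_add P I hPinter
    _ ≤ _ := by gcongr

theorem IsMaxClique.card_erase_filter_adj_le
    (hμ : ∀ x y, x ≠ y → ¬ G.Adj x y → #(G.neighborFinset x ∩ G.neighborFinset y) ≤ X + 1)
    {z : V} {c : Finset V} (hc : IsMaxClique G c) (hx : x ∈ c) (hz : G.Adj x z) (hzc : z ∉ c) :
    #{w ∈ c.erase x | G.Adj z w} ≤ X := by
  obtain ⟨w, hw, hzw⟩ := hc.exists_not_adj hzc
  have hxw : x ≠ w := by rintro rfl; exact hzw hz.symm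
  refine (card_le_card fun u hu => ?_).trans (card_neighborFinset_inter_inter_le hμ hz
    (hc.adj hx hw hxw) (ne_of_mem_of_not_mem hw hzc).symm hzw)
  simp only [mem_filter, mem_erase] at hu
  simp only [mem_inter, SimpleGraph.mem_neighborFinset]
  exact ⟨hc.adj hx hu.1.2 hu.1.1.symm, hu.2, hc.adj hw hu.1.2 fun h => hzw (h ▸ hu.2)⟩

/-- The neighbours of `x` that are neither equal nor adjacent to a leaf other than `i` of the claw
with leaves `I`. When no claw at `x` has more leaves, they form a clique together with `x`. -/
def privateNeighbors (G : SimpleGraph V) [DecidableRel G.Adj] (x : V) (I : Finset V) (i : V) :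
    Finset V :=
  {z ∈ G.neighborFinset x | ∀ j ∈ I, j ≠ i → z ≠ j ∧ ¬ G.Adj z j}

theorem mem_privateNeighbors {I : Finset V} {i z : V} : z ∈ privateNeighbors G x I i ↔
    G.Adj x z ∧ ∀ j ∈ I, j ≠ i → z ≠ j ∧ ¬ G.Adj z j := by
  simp [privateNeighbors]

theorem IsClaw.mem_privateNeighbors_self {I : Finset V} (hI : IsClaw G x I) {i : V} (hi : i ∈ I) :
    i ∈ privateNeighbors G x I i :=
  mem_privateNeighbors.2 ⟨hI.adj i hi, fun _ hj hji => ⟨hji.symm, hI.not_adj hi hj⟩⟩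

theorem IsClaw.le_card_privateNeighbors
    (hl : ∀ x y, G.Adj x y → #(G.neighborFinset x ∩ G.neighborFinset y) = ℓ)
    (hμ : ∀ x y, x ≠ y → ¬ G.Adj x y → #(G.neighborFinset x ∩ G.neighborFinset y) ≤ X + 1)
    {I : Finset V} (hI : IsClaw G x I) {i : V} (hi : i ∈ I) :
    ℓ + 1 + X ≤ #(privateNeighbors G x I i) + #I * X := by
  have hcover : insert i (G.neighborFinset x ∩ G.neighborFinset i) ⊆
      privateNeighbors G x I i ∪ (I.erase i).biUnion fun j =>
        G.neighborFinset x ∩ (G.neighborFinset i ∩ G.neighborFinset j) := by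
    refine insert_subset (mem_union_left _ (hI.mem_privateNeighbors_self hi)) fun w hw => ?_
    simp only [mem_inter, SimpleGraph.mem_neighborFinset] at hw
    simp only [mem_union, mem_privateNeighbors, mem_biUnion, mem_erase, mem_inter,
      SimpleGraph.mem_neighborFinset]
    by_contra! hcon
    obtain ⟨j, hj, hji, hwj⟩ := hcon.1 hw.1
    have hwj' : w ≠ j := by rintro rfl; exact hI.not_adj hi hj hw.2
    exact hcon.2 j ⟨hji, hj⟩ hw.1 hw.2 (hwj hwj').symm
  have hbad : #((I.erase i).biUnion fun j =>
      G.neighborFinset x ∩ (G.neighborFinset i ∩ G.neighborFinset j)) ≤ #(I.erase i) * X := by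
    refine card_biUnion_le_card_mul _ _ _ fun j hj => ?_
    obtain ⟨hji, hj⟩ := mem_erase.1 hj
    exact card_neighborFinset_inter_inter_le hμ (hI.adj i hi) (hI.adj j hj) hji.symm
      (hI.not_adj hi hj)
  have hcard := (card_le_card hcover).trans (card_union_le _ _)
  rw [card_insert_of_notMem (by simp), hl x i (hI.adj i hi)] at hcard
  rw [← card_erase_add_one hi, add_mul, one_mul]
  omega

theorem IsClaw.isClique_insert_privateNeighbors {I : Finset V} (hI : IsClaw G x I)
    (hmax : ∀ J, IsClaw G x J → #J ≤ #I) {i : V} (hi : i ∈ I) :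
    G.IsClique (insert x (privateNeighbors G x I i) : Finset V) := by
  rw [coe_insert]
  refine SimpleGraph.IsClique.insert (fun y hy z hz hyz => ?_)
    fun y hy _ => (mem_privateNeighbors.1 hy).1
  by_contra hn
  obtain ⟨hxy, hy⟩ := mem_privateNeighbors.1 hy
  obtain ⟨hxz, hz⟩ := mem_privateNeighbors.1 hz
  have hzI : z ∉ I.erase i := fun h => (hz z (mem_of_mem_erase h) (ne_of_mem_erase h)).1 rfl
  have hyI : y ∉ I.erase i := fun h => (hy y (mem_of_mem_erase h) (ne_of_mem_erase h)).1 rfl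
  have hJ : IsClaw G x (insert y (insert z (I.erase i))) := by
    refine ((hI.subset (erase_subset i I)).insert_of_adj hxz fun j hj => ?_).insert_of_adj hxy
      fun j hj => ?_
    · exact (hz j (mem_of_mem_erase hj) (ne_of_mem_erase hj)).2
    · obtain rfl | hj := mem_insert.1 hj
      · exact hn
      · exact (hy j (mem_of_mem_erase hj) (ne_of_mem_erase hj)).2
  have hle := hmax _ hJ
  rw [card_insert_of_notMem (by simp [hyz, hyI]), card_insert_of_notMem hzI] at hle
  have := card_erase_add_one hi
  omega

theorem IsClaw.exists_insert
    (hμ : ∀ x y, x ≠ y → ¬ G.Adj x y → #(G.neighborFinset x ∩ G.neighborFinset y) ≤ X + 1)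
    {W c Q : Finset V} (hW : IsClaw G x W) (hc : IsMaxClique G c) (hx : x ∈ c) (hQ : Q ⊆ c.erase x)
    (hWc : Disjoint W c) (hcard : #W * X < #Q) :
    ∃ w ∈ Q, w ∉ W ∧ IsClaw G x (insert w W) := by
  have hbad : #(W.biUnion fun a => {w ∈ c.erase x | G.Adj a w}) ≤ #W * X :=
    card_biUnion_le_card_mul _ _ _ fun a ha =>
      hc.card_erase_filter_adj_le hμ hx (hW.adj a ha) (Finset.disjoint_left.1 hWc ha)
  obtain ⟨w, hwQ, hw⟩ := exists_mem_notMem_of_card_lt_card (hbad.trans_lt hcard)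
  obtain ⟨hwx, hwc⟩ := mem_erase.1 (hQ hwQ)
  refine ⟨w, hwQ, Finset.disjoint_right.1 hWc hwc, hW.insert_of_adj (hc.adj hx hwc hwx.symm) ?_⟩
  exact fun a ha haw => hw (mem_biUnion.2 ⟨a, ha, mem_filter.2 ⟨hQ hwQ, haw.symm⟩⟩)

/-- Starting from the claw `{z}`, one leaf is added inside each clique `L i`. -/
theorem exists_isClaw_card_eq_succ
    (hμ : ∀ x y, x ≠ y → ¬ G.Adj x y → #(G.neighborFinset x ∩ G.neighborFinset y) ≤ X + 1)
    {I : Finset V} {L Q : V → Finset V}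
    (hL : ∀ i ∈ I, IsMaxClique G (L i)) (hx : ∀ i ∈ I, x ∈ L i)
    (hQ : ∀ i ∈ I, Q i ⊆ (L i).erase x)
    (hQL : ∀ i ∈ I, ∀ j ∈ I, j ≠ i → Disjoint (Q j) (L i))
    (hcard : ∀ i ∈ I, #I * X < #(Q i)) {z : V} (hz : G.Adj x z) (hzL : ∀ i ∈ I, z ∉ L i) :
    ∃ W, IsClaw G x W ∧ #W = #I + 1 := by
  suffices key : ∀ J ⊆ I, ∃ W, IsClaw G x W ∧ #W = #J + 1 ∧ ∀ i ∈ I, i ∉ J → Disjoint W (L i) by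
    obtain ⟨W, hW, hWcard, -⟩ := key I Subset.rfl
    exact ⟨W, hW, hWcard⟩
  intro J
  induction J using Finset.induction_on with
  | empty => exact fun _ => ⟨{z}, ⟨by simpa using hz, by simp⟩, by simp, by simpa using hzL⟩
  | insert i J hiJ ih =>
    intro hJ
    obtain ⟨hi, hJI⟩ := insert_subset_iff.1 hJ
    obtain ⟨W, hW, hWcard, hWL⟩ := ih hJI
    have hWI : #W ≤ #I := by
      rw [hWcard, ← card_insert_of_notMem hiJ]
      exact card_le_card hJ
    obtain ⟨w, hwQ, hwW, hw⟩ := hW.exists_insert hμ (hL i hi) (hx i hi) (hQ i hi)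
      (hWL i hi hiJ) ((Nat.mul_le_mul_right X hWI).trans_lt (hcard i hi))
    refine ⟨_, hw, by rw [card_insert_of_notMem hwW, card_insert_of_notMem hiJ, hWcard],
      fun j hj hjJ => ?_⟩
    rw [mem_insert, not_or] at hjJ
    exact disjoint_insert_left.2 ⟨Finset.disjoint_left.1 (hQL j hj i hi (Ne.symm hjJ.1)) hwQ,
      hWL j hj hjJ.2⟩

theorem exists_local_cover
    (hl : ∀ x y, G.Adj x y → #(G.neighborFinset x ∩ G.neighborFinset y) = ℓ)
    (hμ : ∀ x y, x ≠ y → ¬ G.Adj x y → #(G.neighborFinset x ∩ G.neighborFinset y) ≤ X + 1)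
    (hs : 2 * s * X < ℓ + 1 + X) (hclaw : ∀ x I, IsClaw G x I → #I ≤ s) (x : V) :
    ∃ F : Finset (Finset V), #F ≤ s ∧
      (∀ c ∈ F, IsMaxClique G c ∧ x ∈ c ∧ ℓ + 2 + X ≤ #c + s * X) ∧
      ∀ z, G.Adj x z → ∃ c ∈ F, z ∈ c := by
  classical
  obtain ⟨I, hI, hmax⟩ := exists_max_image {I : Finset V | IsClaw G x I} card
    ⟨∅, by simp [isClaw_empty]⟩
  simp only [mem_filter_univ] at hI hmax
  have hIs : #I * X ≤ s * X := Nat.mul_le_mul_right X (hclaw x I hI)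
  choose! L hL using fun i (hi : i ∈ I) =>
    exists_isMaxClique_superset (hI.isClique_insert_privateNeighbors hmax hi)
  have hcard := fun i hi => hI.le_card_privateNeighbors hl hμ (i := i) hi
  have hxQ : ∀ i, x ∉ privateNeighbors G x I i := fun i h => (mem_privateNeighbors.1 h).1.ne rfl
  have hxL : ∀ i ∈ I, x ∈ L i := fun i hi => (hL i hi).2 (mem_insert_self _ _)
  have hQL : ∀ i ∈ I, privateNeighbors G x I i ⊆ L i :=
    fun i hi => (subset_insert _ _).trans (hL i hi).2
  refine ⟨I.image L, card_image_le.trans (hclaw x I hI), ?_, fun z hz => ?_⟩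
  · simp only [forall_mem_image]
    intro i hi
    have hle := card_le_card (hL i hi).2
    rw [card_insert_of_notMem (hxQ i)] at hle
    have := hcard i hi
    exact ⟨(hL i hi).1, hxL i hi, by omega⟩
  · by_contra! hzL
    have hdisj : ∀ i ∈ I, ∀ j ∈ I, j ≠ i → Disjoint (privateNeighbors G x I j) (L i) := by
      refine fun i hi j _ hji => Finset.disjoint_left.2 fun w hw hwL => ?_
      have hwi := (mem_privateNeighbors.1 hw).2 i hi hji.symm
      exact hwi.2 ((hL i hi).1.adj hwL (hQL i hi (hI.mem_privateNeighbors_self hi)) hwi.1)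
    have hlarge : ∀ i ∈ I, #I * X < #(privateNeighbors G x I i) := fun i hi => by
      have := hcard i hi
      have : 2 * s * X = s * X + s * X := by ring
      omega
    obtain ⟨W, hW, hWcard⟩ := exists_isClaw_card_eq_succ hμ (fun i hi => (hL i hi).1) hxL
      (fun i hi => subset_erase.2 ⟨hQL i hi, hxQ i⟩) hdisj hlarge hz
      fun i hi => hzL _ (mem_image_of_mem L hi)
    have := hmax W hW
    omega

theorem IsMaxClique.card_inter_le
    (hμ : ∀ x y, x ≠ y → ¬ G.Adj x y → #(G.neighborFinset x ∩ G.neighborFinset y) ≤ X + 1)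
    {c d : Finset V} (hc : IsMaxClique G c) (hd : IsMaxClique G d) (hcd : c ≠ d) :
    #(c ∩ d) ≤ X + 1 := by
  obtain ⟨a, hac, had⟩ := not_subset.1 fun h => hcd (hc.eq_of_le hd.prop h)
  obtain ⟨b, hbd, hab⟩ := hd.exists_not_adj had
  refine (card_le_card fun w hw => ?_).trans (hμ a b (ne_of_mem_of_not_mem hbd had).symm hab)
  obtain ⟨hwc, hwd⟩ := mem_inter.1 hw
  have haw := hc.adj hac hwc (ne_of_mem_of_not_mem hwd had).symm
  simp only [mem_inter, SimpleGraph.mem_neighborFinset]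
  exact ⟨haw, hd.adj hbd hwd fun h => hab (h ▸ haw)⟩

theorem card_union_le_of_isClique {c d : Finset V} (hc : G.IsClique c) (hd : G.IsClique d)
    {x y : V} (hx : x ∈ c ∩ d) (hy : y ∈ c ∩ d) :
    #(c ∪ d) ≤ #(G.neighborFinset x ∩ G.neighborFinset y) + 2 := by
  obtain ⟨hxc, hxd⟩ := mem_inter.1 hx
  obtain ⟨hyc, hyd⟩ := mem_inter.1 hy
  have hsub : c ∪ d ⊆ insert x
      (insert y (G.neighborFinset x ∩ G.neighborFinset y)) := by
    intro w hw
    simp only [mem_insert, mem_inter, SimpleGraph.mem_neighborFinset, or_iff_not_imp_left]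
    intro hwx hwy
    rcases mem_union.1 hw with hw | hw
    · exact ⟨hc hxc hw (Ne.symm hwx), hc hyc hw (Ne.symm hwy)⟩
    · exact ⟨hd hxd hw (Ne.symm hwx), hd hyd hw (Ne.symm hwy)⟩
  exact (card_le_card hsub).trans
    ((card_insert_le _ _).trans (Nat.succ_le_succ (card_insert_le _ _)))

/-- A family of maximal cliques ("lines") such that every edge is in exactly one of them. -/
structure IsLineSystem (G : SimpleGraph V) (F : Finset (Finset V)) : Prop where
  isMaxClique : ∀ c ∈ F, IsMaxClique G c
  cover : ∀ x y, G.Adj x y → ∃ c ∈ F, x ∈ c ∧ y ∈ c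
  unique : ∀ x y, x ≠ y → ∀ c ∈ F, ∀ d ∈ F, x ∈ c → y ∈ c → x ∈ d → y ∈ d → c = d

/-- Metsch's theorem on large cliques. The lines are the maximal cliques with at least
`ℓ + 2 + X - s * X` vertices. -/
theorem exists_isLineSystem
    (hl : ∀ x y, G.Adj x y → #(G.neighborFinset x ∩ G.neighborFinset y) = ℓ)
    (hμ : ∀ x y, x ≠ y → ¬ G.Adj x y → #(G.neighborFinset x ∩ G.neighborFinset y) ≤ X + 1)
    (hs : 2 * s * X < ℓ + 1 + X) (hclaw : ∀ x I, IsClaw G x I → #I ≤ s) :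
    ∃ F, IsLineSystem G F ∧ (∀ c ∈ F, ℓ + 2 + X ≤ #c + s * X) ∧ ∀ x, #{c ∈ F | x ∈ c} ≤ s := by
  classical
  have hlocal := exists_local_cover hl hμ hs hclaw
  have htwo : 2 * s * X = s * X + s * X := by ring
  let F : Finset (Finset V) := {c | IsMaxClique G c ∧ ℓ + 2 + X ≤ #c + s * X}
  have hF : ∀ c, c ∈ F ↔ IsMaxClique G c ∧ ℓ + 2 + X ≤ #c + s * X := by simp [F]
  have hunique : ∀ x y, x ≠ y → ∀ c ∈ F, ∀ d ∈ F, x ∈ c → y ∈ c → x ∈ d → y ∈ d → c = d := by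
    intro x y hxy c hc d hd hxc hyc hxd hyd
    by_contra hcd
    obtain ⟨hc, hccard⟩ := (hF c).1 hc
    obtain ⟨hd, hdcard⟩ := (hF d).1 hd
    have hinter := hc.card_inter_le hμ hd hcd
    have hunion := card_union_le_of_isClique hc.prop hd.prop (mem_inter.2 ⟨hxc, hxd⟩)
      (mem_inter.2 ⟨hyc, hyd⟩)
    rw [hl x y (hc.adj hxc hyc hxy)] at hunion
    have := card_union_add_card_inter c d
    omega
  refine ⟨F, ⟨fun c hc => ((hF c).1 hc).1, fun x y hxy => ?_, hunique⟩,
    fun c hc => ((hF c).1 hc).2, fun x => ?_⟩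
  · obtain ⟨E, -, hE, hcover⟩ := hlocal x
    obtain ⟨c, hc, hyc⟩ := hcover y hxy
    exact ⟨c, (hF c).2 ⟨(hE c hc).1, (hE c hc).2.2⟩, (hE c hc).2.1, hyc⟩
  · obtain ⟨E, hEcard, hE, hcover⟩ := hlocal x
    refine (card_le_card fun c hc => ?_).trans hEcard
    obtain ⟨hcF, hxc⟩ := mem_filter.1 hc
    obtain ⟨hc, hccard⟩ := (hF c).1 hcF
    obtain ⟨z, hz, hzx⟩ := exists_mem_ne (show 1 < #c by omega) x
    obtain ⟨d, hd, hzd⟩ := hcover z (hc.adj hxc hz hzx.symm)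
    rwa [hunique x z hzx.symm c hcF d ((hF d).2 ⟨(hE d hd).1, (hE d hd).2.2⟩) hxc hz
      (hE d hd).2.1 hzd]

end Claws

section Spectrum

open Matrix

theorem posSemidef_of_mul_self_eq_smul {n : Type*} [Fintype n] {M : Matrix n n ℝ} (hM : M.IsSymm)
    {c : ℝ} (hc : 0 < c) (h : M * M = c • M) : M.PosSemidef := by
  have hM' : M = c⁻¹ • (Mᴴ * M) := by
    rw [conjTranspose_eq_transpose_of_trivial, hM.eq, h, smul_smul, inv_mul_cancel₀ hc.ne',
      one_smul]
  rw [hM']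
  exact (posSemidef_conjTranspose_mul_self M).smul (inv_nonneg.2 hc.le)

/-- The all-ones matrix. -/
def allOnes (n : Type*) : Matrix n n ℝ :=
  of fun _ _ => 1

theorem isSymm_allOnes {n : Type*} : (allOnes n).IsSymm := rfl

theorem posSemidef_allOnes {n : Type*} [Finite n] : (allOnes n).PosSemidef := by
  convert posSemidef_vecMulVec_self_star (1 : n → ℝ)
  ext; simp [allOnes, vecMulVec_apply]

theorem isSymm_linearComb {V : Type*} [DecidableEq V] (G : SimpleGraph V) [DecidableRel G.Adj]
    (a b c : ℝ) : (a • (1 : Matrix V V ℝ) + b • G.adjMatrix ℝ + c • allOnes V).IsSymm :=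
  ((isSymm_one.smul _).add ((G.isSymm_adjMatrix (α := ℝ)).smul _)).add (isSymm_allOnes.smul _)

variable {V : Type*} [Fintype V]

theorem allOnes_mul_self : allOnes V * allOnes V = (Fintype.card V : ℝ) • allOnes V := by
  ext; simp [allOnes, mul_apply]

variable {G : SimpleGraph V} [DecidableRel G.Adj] {v k ℓ μ m : ℕ}

theorem adjMatrix_mul_allOnes (hG : G.IsRegularOfDegree k) :
    G.adjMatrix ℝ * allOnes V = (k : ℝ) • allOnes V := by
  ext; simp [allOnes, hG.degree_eq]

theorem allOnes_mul_adjMatrix (hG : G.IsRegularOfDegree k) :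
    allOnes V * G.adjMatrix ℝ = (k : ℝ) • allOnes V := by
  ext; simp [allOnes, hG.degree_eq]

theorem adjMatrix_mul_self [DecidableEq V] (hG : G.IsSRGWith v k ℓ μ) :
    G.adjMatrix ℝ * G.adjMatrix ℝ =
      ((k : ℝ) - μ) • (1 : Matrix V V ℝ) + ((ℓ : ℝ) - μ) • G.adjMatrix ℝ + (μ : ℝ) • allOnes V := by
  have hcompl : Gᶜ.adjMatrix ℝ = allOnes V - 1 - G.adjMatrix ℝ := by
    ext x y
    by_cases hxy : x = y
    · simp [allOnes, hxy]
    · by_cases hadj : G.Adj x y <;> simp [allOnes, SimpleGraph.adjMatrix_apply, hxy, hadj]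
  rw [← sq, hG.matrix_eq (α := ℝ), hcompl]
  module

theorem mul_self_linearComb [DecidableEq V] (hG : G.IsSRGWith v k ℓ μ) (a b c : ℝ) :
    (a • (1 : Matrix V V ℝ) + b • G.adjMatrix ℝ + c • allOnes V) *
        (a • (1 : Matrix V V ℝ) + b • G.adjMatrix ℝ + c • allOnes V) =
      (a ^ 2 + b ^ 2 * (k - μ)) • (1 : Matrix V V ℝ) +
        (2 * a * b + b ^ 2 * (ℓ - μ)) • G.adjMatrix ℝ +
        (2 * a * c + 2 * b * c * k + b ^ 2 * μ + c ^ 2 * v) • allOnes V := by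
  have hJ := allOnes_mul_self (V := V)
  rw [hG.card] at hJ
  simp only [mul_add, add_mul, smul_mul_smul_comm, one_mul, mul_one, adjMatrix_mul_self hG, hJ,
    adjMatrix_mul_allOnes hG.regular, allOnes_mul_adjMatrix hG.regular]
  module

theorem mu_mul_card_eq [Nonempty V] (hG : G.IsSRGWith v k ℓ μ) :
    (μ : ℝ) * v = k ^ 2 - (k - μ) - (ℓ - μ) * k := by
  classical
  obtain ⟨x⟩ := ‹Nonempty V›
  have hAAJ := congrArg (· * allOnes V) (adjMatrix_mul_self hG)
  have hJ := allOnes_mul_self (V := V)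
  rw [hG.card] at hJ
  simp only [mul_assoc, add_mul, smul_mul_assoc, one_mul, adjMatrix_mul_allOnes hG.regular, hJ,
    mul_smul_comm] at hAAJ
  have hentry := congrFun (congrFun hAAJ x) x
  simp only [allOnes, Matrix.smul_apply, Matrix.add_apply, of_apply, smul_eq_mul, mul_one]
    at hentry
  linear_combination -hentry

theorem card_neighborFinset_inter [DecidableEq V] (x y : V) :
    #(G.neighborFinset x ∩ G.neighborFinset y) = Fintype.card (G.commonNeighbors x y) := by
  rw [← Set.toFinset_card]
  congr 1
  ext; simp [SimpleGraph.mem_commonNeighbors]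

/-- A strongly regular graph with `μ > 0` and smallest eigenvalue `-m`, where `m ≥ 2`. The
eigenvalue is encoded by `valency_eq`: `-m` is a root of the equation `t² = (ℓ - μ) t + (k - μ)` of
the eigenvalues other than `k`. The second root, `ℓ - μ + m`, is required to be positive. -/
structure IsSRGWithSmallest (G : SimpleGraph V) [DecidableRel G.Adj] (v k ℓ μ m : ℕ) : Prop
    extends G.IsSRGWith v k ℓ μ where
  mu_pos : 0 < μ
  mu_lt : μ < ℓ + m
  two_le : 2 ≤ m
  valency_eq : (k : ℝ) = μ + m * (ℓ - μ + m)

namespace IsSRGWithSmallest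

section

variable (h : IsSRGWithSmallest G v k ℓ μ m)
include h

theorem m_pos : (0 : ℝ) < m :=
  mod_cast zero_lt_two.trans_le h.two_le

theorem theta_pos : (0 : ℝ) < ℓ - μ + m := by
  have hμ : (μ : ℝ) < ℓ + m := mod_cast h.mu_lt
  linarith

theorem k_pos : 0 < k := by
  have hθ := h.theta_pos
  have hμ : (0 : ℝ) < μ := mod_cast h.mu_pos
  have : (0 : ℝ) < k := by rw [h.valency_eq]; positivity
  exact_mod_cast this

theorem k_add_m_pos : (0 : ℝ) < k + m := by
  have := h.k_pos
  positivity

theorem theta_add_m_pos : (0 : ℝ) < ℓ - μ + 2 * m := by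
  linarith [h.theta_pos, h.m_pos]

theorem mu_mul_card [Nonempty V] : (μ : ℝ) * v = (k + m) * (k - (ℓ - μ + m)) := by
  linear_combination mu_mul_card_eq h.toIsSRGWith - h.valency_eq

end

variable [DecidableEq V]

theorem card_common_of_adj (h : IsSRGWithSmallest G v k ℓ μ m) {x y : V} (hxy : G.Adj x y) :
    #(G.neighborFinset x ∩ G.neighborFinset y) = ℓ := by
  rw [card_neighborFinset_inter, h.of_adj x y hxy]

theorem card_common_of_not_adj (h : IsSRGWithSmallest G v k ℓ μ m) {x y : V} (hxy : x ≠ y)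
    (hn : ¬ G.Adj x y) : #(G.neighborFinset x ∩ G.neighborFinset y) = μ := by
  rw [card_neighborFinset_inter, h.of_not_adj hxy hn]

end IsSRGWithSmallest

variable [DecidableEq V]

/-- A multiple of the orthogonal projection onto the `-m`-eigenspace of a strongly regular graph
with smallest eigenvalue `-m`. -/
noncomputable def eigenMatrix (G : SimpleGraph V) [DecidableRel G.Adj] (k ℓ μ m : ℕ) :
    Matrix V V ℝ :=
  ((ℓ : ℝ) - μ + m) • (1 : Matrix V V ℝ) + (-1 : ℝ) • G.adjMatrix ℝ +
    ((μ : ℝ) / (k + m)) • allOnes V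

namespace IsSRGWithSmallest

theorem eigenMatrix_mul_self [Nonempty V] (h : IsSRGWithSmallest G v k ℓ μ m) :
    eigenMatrix G k ℓ μ m * eigenMatrix G k ℓ μ m =
      ((ℓ : ℝ) - μ + 2 * m) • eigenMatrix G k ℓ μ m := by
  have hkm := h.k_add_m_pos.ne'
  rw [eigenMatrix, mul_self_linearComb h.toIsSRGWith]
  match_scalars
  · linear_combination h.valency_eq
  · ring
  · field_simp
    linear_combination (μ : ℝ) * h.mu_mul_card

theorem posSemidef_eigenMatrix [Nonempty V] (h : IsSRGWithSmallest G v k ℓ μ m) :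
    (eigenMatrix G k ℓ μ m).PosSemidef :=
  posSemidef_of_mul_self_eq_smul (isSymm_linearComb G _ _ _) h.theta_add_m_pos
    h.eigenMatrix_mul_self

/-- Away from the all-ones vector, `A + m` is `(ℓ - μ + 2 m)` times a projection. -/
theorem posSemidef_adjMatrix_add [Nonempty V] (h : IsSRGWithSmallest G v k ℓ μ m) :
    (G.adjMatrix ℝ + (m : ℝ) • (1 : Matrix V V ℝ)).PosSemidef := by
  have hv : (0 : ℝ) < v := by rw [← h.card]; exact_mod_cast Fintype.card_pos
  have hproj : ((m : ℝ) • (1 : Matrix V V ℝ) + (1 : ℝ) • G.adjMatrix ℝ +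
      (-((k : ℝ) + m) / v) • allOnes V).PosSemidef := by
    refine posSemidef_of_mul_self_eq_smul (isSymm_linearComb G _ _ _) h.theta_add_m_pos ?_
    rw [mul_self_linearComb h.toIsSRGWith]
    match_scalars
    · linear_combination h.valency_eq
    · ring
    · field_simp
      linear_combination h.mu_mul_card
  have hsum := hproj.add (posSemidef_allOnes.smul (div_nonneg h.k_add_m_pos.le hv.le))
  convert hsum using 1
  module

end IsSRGWithSmallest

/-- The characteristic vector of a set of vertices. -/
def charVec (c : Finset V) (x : V) : ℝ :=
  if x ∈ c then 1 else 0

theorem charVec_dotProduct (c : Finset V) (w : V → ℝ) : charVec c ⬝ᵥ w = ∑ x ∈ c, w x := by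
  simp [charVec, dotProduct, sum_ite_mem]

theorem sum_charVec (c : Finset V) : ∑ x, charVec c x = #c := by
  simp [charVec]

theorem adjMatrix_mulVec_charVec (c : Finset V) (x : V) :
    (G.adjMatrix ℝ *ᵥ charVec c) x = #(G.neighborFinset x ∩ c) := by
  simp [SimpleGraph.adjMatrix_mulVec_apply, charVec, sum_ite_mem]

theorem eigenMatrix_mulVec_charVec (c : Finset V) (x : V) :
    (eigenMatrix G k ℓ μ m *ᵥ charVec c) x =
      (ℓ - μ + m) * charVec c x - #(G.neighborFinset x ∩ c) + μ / (k + m) * #c := by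
  have hJ : (allOnes V *ᵥ charVec c) x = #c := by
    simp [allOnes, mulVec, dotProduct, sum_charVec]
  simp only [eigenMatrix, add_mulVec, smul_mulVec, one_mulVec, Pi.add_apply, Pi.smul_apply,
    adjMatrix_mulVec_charVec, hJ, smul_eq_mul]
  ring

theorem charVec_dotProduct_eigenMatrix (c : Finset V) :
    charVec c ⬝ᵥ (eigenMatrix G k ℓ μ m *ᵥ charVec c) =
      (ℓ - μ + m) * #c - ∑ x ∈ c, (#(G.neighborFinset x ∩ c) : ℝ) + μ / (k + m) * #c ^ 2 := by
  have hone : ∑ x ∈ c, charVec c x = #c := by simp [charVec]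
  simp only [charVec_dotProduct, eigenMatrix_mulVec_charVec, sum_add_distrib, sum_sub_distrib,
    ← mul_sum, hone, sum_const, nsmul_eq_mul]
  ring

theorem card_neighborFinset_inter_of_isClique {c : Finset V} (hc : G.IsClique c) {x : V}
    (hx : x ∈ c) : (#(G.neighborFinset x ∩ c) : ℝ) = #c - 1 := by
  have : G.neighborFinset x ∩ c = c.erase x := by
    ext y
    simp only [mem_inter, SimpleGraph.mem_neighborFinset, mem_erase]
    exact ⟨fun h => ⟨h.1.ne', h.2⟩, fun h => ⟨hc hx h.2 h.1.symm, h.2⟩⟩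
  rw [this, ← card_erase_add_one hx]
  push_cast
  ring

namespace IsSRGWithSmallest

theorem charVec_dotProduct_eigenMatrix_of_isClique (h : IsSRGWithSmallest G v k ℓ μ m)
    {c : Finset V} (hc : G.IsClique c) :
    (charVec c ⬝ᵥ (eigenMatrix G k ℓ μ m *ᵥ charVec c)) * (k + m) =
      #c * (ℓ - μ + m + 1) * (k + m - m * #c) := by
  have hkm := h.k_add_m_pos.ne'
  rw [charVec_dotProduct_eigenMatrix,
    sum_congr rfl fun x hx => card_neighborFinset_inter_of_isClique hc hx, sum_const, nsmul_eq_mul]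
  field_simp
  linear_combination (-(#c : ℝ) ^ 2) * h.valency_eq

omit [DecidableEq V] in
/-- The Delsarte bound. -/
theorem mul_card_le_of_isClique [Nonempty V] (h : IsSRGWithSmallest G v k ℓ μ m) {c : Finset V}
    (hc : G.IsClique c) : m * #c ≤ k + m := by
  classical
  obtain rfl | hne := c.eq_empty_or_nonempty
  · simp
  have hform := mul_nonneg (h.posSemidef_eigenMatrix.dotProduct_mulVec_nonneg (charVec c))
    h.k_add_m_pos.le
  rw [star_trivial, h.charVec_dotProduct_eigenMatrix_of_isClique hc] at hform
  have hpos : (0 : ℝ) < #c * (ℓ - μ + m + 1) :=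
    mul_pos (mod_cast hne.card_pos) (by linarith [h.theta_pos])
  have := nonneg_of_mul_nonneg_right hform hpos
  have : (m * #c : ℝ) ≤ k + m := by linarith
  exact_mod_cast this

/-- Equality in the Delsarte bound forces the characteristic vector of the clique into the kernel
of `eigenMatrix`. -/
theorem mul_card_neighborFinset_inter_eq [Nonempty V] (h : IsSRGWithSmallest G v k ℓ μ m)
    {c : Finset V} (hc : G.IsClique c) (hcard : m * #c = k + m) {y : V} (hy : y ∉ c) :
    m * #(G.neighborFinset y ∩ c) = μ := by
  have hkm := h.k_add_m_pos.ne'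
  have hcard' : (m * #c : ℝ) = k + m := mod_cast hcard
  have hform := h.charVec_dotProduct_eigenMatrix_of_isClique hc
  rw [hcard', sub_self, mul_zero, mul_eq_zero, or_iff_left hkm] at hform
  have hker := (h.posSemidef_eigenMatrix.dotProduct_mulVec_zero_iff (charVec c)).1
    (by rwa [star_trivial])
  have hentry := congrFun hker y
  rw [eigenMatrix_mulVec_charVec, charVec, if_neg hy, Pi.zero_apply] at hentry
  have hreal : (m * #(G.neighborFinset y ∩ c) : ℝ) = μ := by
    field_simp at hentry
    refine mul_right_cancel₀ hkm ?_
    linear_combination (-m : ℝ) * hentry + (μ : ℝ) * hcard'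
  exact_mod_cast hreal

omit [DecidableEq V] in
theorem dvd_mu [Nonempty V] (h : IsSRGWithSmallest G v k ℓ μ m) {c : Finset V}
    (hc : G.IsClique c) (hcard : m * #c = k + m) : m ∣ μ := by
  classical
  obtain ⟨y, hy⟩ : ∃ y, y ∉ c := by
    by_contra! hall
    obtain ⟨x⟩ := ‹Nonempty V›
    have hkv : k < v := by
      rw [← h.regular.degree_eq x, ← h.card]
      exact G.degree_lt_card_verts x
    rw [eq_univ_of_forall hall, card_univ, h.card] at hcard
    nlinarith [h.two_le, h.k_pos]
  exact ⟨_, (h.mul_card_neighborFinset_inter_eq hc hcard hy).symm⟩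

omit [DecidableEq V] in
/-- With `e = μ / m` this is the valency equation divided by `m`. -/
theorem cast_card_eq (h : IsSRGWithSmallest G v k ℓ μ m) {K e : ℕ} (hK : m * K = k + m)
    (he : m * e = μ) : (K : ℤ) = ℓ - m * e + e + m + 1 := by
  have hval : (k : ℤ) = μ + m * (ℓ - μ + m) := by exact_mod_cast h.valency_eq
  have hK' : (m * K : ℤ) = k + m := mod_cast hK
  have he' : (m * e : ℤ) = μ := mod_cast he
  have hm : (m : ℤ) ≠ 0 := by have := h.two_le; omega
  refine mul_left_cancel₀ hm ?_
  linear_combination hK' + hval + (m - 1 : ℤ) * he'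

end IsSRGWithSmallest

end Spectrum

section Lines

variable {V : Type*} [Fintype V] [DecidableEq V] {G : SimpleGraph V} {F : Finset (Finset V)}

theorem mul_card_le_card_of_card_filter_mem_le {s t : ℕ} (hs : 0 < s)
    (hF : ∀ x, #{c ∈ F | x ∈ c} ≤ s) (hcard : ∀ c ∈ F, t * s ≤ #c) : t * #F ≤ Fintype.card V := by
  refine Nat.le_of_mul_le_mul_right ?_ hs
  calc t * #F * s = #F * (t * s) := by ring
    _ ≤ ∑ c ∈ F, #c := by simpa using card_nsmul_le_sum _ _ _ hcard
    _ = ∑ x : V, #{c ∈ F | x ∈ c} := by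
      simpa [bipartiteAbove, bipartiteBelow] using
        sum_card_bipartiteAbove_eq_sum_card_bipartiteBelow (s := F) (t := univ) (fun c x => x ∈ c)
    _ ≤ Fintype.card V * s := by simpa using sum_le_card_nsmul univ _ s fun x _ => hF x

omit [Fintype V] [DecidableEq V] in
/-- Fewer equations than unknowns. -/
theorem exists_ne_zero_sum_eq_zero_of_card_lt {U : Finset V} (hU : #F < #U) :
    ∃ u : V → ℝ, u ≠ 0 ∧ (∀ x ∉ U, u x = 0) ∧ ∀ c ∈ F, ∑ x ∈ c, u x = 0 := by
  classical
  let T : (U → ℝ) →ₗ[ℝ] F → ℝ :=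
    LinearMap.pi fun c => ∑ x : U with x.1 ∈ c.1, LinearMap.proj x
  obtain ⟨w, hw, hw0⟩ := (Submodule.ne_bot_iff _).1
    (LinearMap.ker_ne_bot_of_finrank_lt (f := T) (by simpa using hU))
  let u : V → ℝ := fun x => if hx : x ∈ U then w ⟨x, hx⟩ else 0
  have hu : ∀ x : U, u x = w x := fun x => by simp [u]
  have hu0 : ∀ x ∉ U, u x = 0 := fun x hx => by simp [u, hx]
  refine ⟨u, fun h0 => hw0 (funext fun x => by rw [← hu, h0]; rfl), hu0, fun c hc => ?_⟩
  have hline : ∑ x : U with x.1 ∈ c, w x = 0 := by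
    simpa [T] using congrFun (LinearMap.mem_ker.1 hw) ⟨c, hc⟩
  have hsum : ∑ x ∈ U, (if x ∈ c then u x else 0) = ∑ x : U, if x.1 ∈ c then w x else 0 := by
    rw [← sum_coe_sort U]
    simp only [hu]
  rw [← hline, sum_filter, ← hsum, sum_ite_mem]
  exact (sum_subset inter_subset_right fun x hxc hx =>
    hu0 x fun hxU => hx (mem_inter.2 ⟨hxU, hxc⟩)).symm

namespace IsLineSystem

omit [Fintype V] in
theorem pairwiseDisjoint_erase (hF : IsLineSystem G F) (p : V) :
    Set.PairwiseDisjoint (SetLike.coe {c ∈ F | p ∈ c}) fun c : Finset V => c.erase p := by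
  intro c hc d hd hcd
  obtain ⟨hc, hpc⟩ := mem_filter.1 hc
  obtain ⟨hd, hpd⟩ := mem_filter.1 hd
  refine disjoint_left.2 fun y hyc hyd => hcd ?_
  rw [mem_erase] at hyc hyd
  exact hF.unique p y hyc.1.symm c hc d hd hpc hyc.2 hpd hyd.2

variable [DecidableRel G.Adj]

theorem erase_subset_neighborFinset (hF : IsLineSystem G F) {p : V} {c : Finset V} (hc : c ∈ F)
    (hp : p ∈ c) : c.erase p ⊆ G.neighborFinset p := by
  intro y hy
  obtain ⟨hyp, hy⟩ := mem_erase.1 hy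
  exact (G.mem_neighborFinset p y).2 ((hF.isMaxClique c hc).adj hp hy hyp.symm)

theorem neighborFinset_eq_biUnion (hF : IsLineSystem G F) (p : V) :
    G.neighborFinset p = {c ∈ F | p ∈ c}.biUnion (·.erase p) := by
  refine Subset.antisymm (fun y hy => ?_) (biUnion_subset.2 fun c hc =>
    hF.erase_subset_neighborFinset (mem_filter.1 hc).1 (mem_filter.1 hc).2)
  have hpy := (G.mem_neighborFinset p y).1 hy
  obtain ⟨c, hc, hp, hyc⟩ := hF.cover p y hpy
  exact mem_biUnion.2 ⟨c, mem_filter.2 ⟨hc, hp⟩, mem_erase.2 ⟨hpy.ne', hyc⟩⟩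

theorem sum_neighborFinset (hF : IsLineSystem G F) {M : Type*} [AddCommMonoid M] (g : V → M)
    (p : V) : ∑ y ∈ G.neighborFinset p, g y = ∑ c ∈ F with p ∈ c, ∑ y ∈ c.erase p, g y := by
  rw [hF.neighborFinset_eq_biUnion, sum_biUnion (hF.pairwiseDisjoint_erase p)]

theorem sum_card_sub_one (hF : IsLineSystem G F) (p : V) :
    ∑ c ∈ F with p ∈ c, (#c - 1) = #(G.neighborFinset p) := by
  rw [card_eq_sum_ones, hF.sum_neighborFinset]
  exact sum_congr rfl fun c hc => by
    rw [← card_eq_sum_ones, card_erase_of_mem (mem_filter.1 hc).2]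

theorem sum_sq_sum (hF : IsLineSystem G F) (u : V → ℝ) :
    ∑ c ∈ F, (∑ x ∈ c, u x) ^ 2 =
      u ⬝ᵥ (G.adjMatrix ℝ).mulVec u + ∑ x, (#{c ∈ F | x ∈ c} : ℝ) * u x ^ 2 := by
  have hsq : ∀ c : Finset V, (∑ x ∈ c, u x) ^ 2 = ∑ x, if x ∈ c then u x * ∑ y ∈ c, u y else 0 :=
    fun c => by rw [sq, sum_mul, sum_ite_mem, univ_inter]
  simp only [hsq, dotProduct]
  rw [sum_comm, ← sum_add_distrib]
  refine sum_congr rfl fun x _ => ?_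
  rw [← sum_filter, ← mul_sum, SimpleGraph.adjMatrix_mulVec_apply, hF.sum_neighborFinset,
    ← sum_congr rfl fun c hc => sum_erase_add c u (mem_filter.1 hc).2, sum_add_distrib, sum_const,
    nsmul_eq_mul]
  ring

end IsLineSystem

variable [DecidableRel G.Adj] {v k ℓ μ m : ℕ}

namespace IsSRGWithSmallest

variable (h : IsSRGWithSmallest G v k ℓ μ m) (hF : IsLineSystem G F)
include h hF

theorem sum_card_lines_sub_one (p : V) : ∑ c ∈ F with p ∈ c, (#c - 1) = k := by
  rw [hF.sum_card_sub_one, G.card_neighborFinset_eq_degree, h.regular.degree_eq]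

omit [DecidableEq V] in
theorem mul_card_sub_one_le {c : Finset V} (hc : c ∈ F) : m * (#c - 1) ≤ k := by
  obtain rfl | ⟨x, -⟩ := c.eq_empty_or_nonempty
  · simp
  have : Nonempty V := ⟨x⟩
  have := h.mul_card_le_of_isClique (hF.isMaxClique c hc).prop
  rw [Nat.mul_sub_one]
  omega

theorem le_card_lines (p : V) : m ≤ #{c ∈ F | p ∈ c} := by
  refine Nat.le_of_mul_le_mul_right ?_ h.k_pos
  calc m * k = ∑ c ∈ F with p ∈ c, m * (#c - 1) := by
        rw [← mul_sum, h.sum_card_lines_sub_one hF]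
    _ ≤ #{c ∈ F | p ∈ c} * k := by
        simpa using sum_le_card_nsmul _ _ _ fun c hc =>
          h.mul_card_sub_one_le hF (mem_filter.1 hc).1

theorem mul_card_eq_of_card_lines_eq {p : V} (hp : #{c ∈ F | p ∈ c} = m) {c : Finset V}
    (hc : c ∈ F) (hpc : p ∈ c) : m * #c = k + m := by
  have hsum : ∑ c ∈ F with p ∈ c, m * (#c - 1) = ∑ c ∈ F with p ∈ c, k := by
    rw [← mul_sum, h.sum_card_lines_sub_one hF, sum_const, hp, smul_eq_mul]
  have hcard := (sum_eq_sum_iff_of_le fun c hc =>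
    h.mul_card_sub_one_le hF (mem_filter.1 hc).1).1 hsum c (mem_filter.2 ⟨hc, hpc⟩)
  rw [← hcard, ← Nat.mul_succ, Nat.succ_eq_add_one, Nat.sub_add_cancel (card_pos.2 ⟨p, hpc⟩)]

/-- Otherwise some nonzero vector supported on these vertices has zero sum on every line, which
contradicts that `A + m` is positive semidefinite. -/
theorem card_irregular_le : #{x | #{c ∈ F | x ∈ c} ≠ m} ≤ #F := by
  by_contra! hlt
  obtain ⟨u, hu, hsupp, hline⟩ := exists_ne_zero_sum_eq_zero_of_card_lt hlt
  obtain ⟨x, hx⟩ := Function.ne_iff.1 hu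
  have : Nonempty V := ⟨x⟩
  have hlines := hF.sum_sq_sum u
  rw [sum_eq_zero fun c hc => by rw [hline c hc, zero_pow two_ne_zero]] at hlines
  have hpsd := h.posSemidef_adjMatrix_add.dotProduct_mulVec_nonneg u
  have hself : u ⬝ᵥ u = ∑ x, u x ^ 2 := by simp only [dotProduct, sq]
  rw [star_trivial, Matrix.add_mulVec, Matrix.smul_mulVec, Matrix.one_mulVec, dotProduct_add,
    dotProduct_smul, hself, smul_eq_mul, mul_sum] at hpsd
  have hlt : ∑ x, (m : ℝ) * u x ^ 2 < ∑ x, (#{c ∈ F | x ∈ c} : ℝ) * u x ^ 2 := by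
    refine sum_lt_sum (fun y _ => ?_) ⟨x, mem_univ x, ?_⟩
    · have := h.le_card_lines hF y
      gcongr
    · have hxm : #{c ∈ F | x ∈ c} ≠ m := by
        by_contra hxm
        exact hx (hsupp x (by simp [hxm]))
      have hm : (m : ℝ) < #{c ∈ F | x ∈ c} :=
        mod_cast (h.le_card_lines hF x).lt_of_ne hxm.symm
      exact mul_lt_mul_of_pos_right hm (pow_two_pos_of_ne_zero hx)
  linarith

omit h in
theorem card_neighborFinset_sdiff_add (hreg : G.IsRegularOfDegree k) {K : ℕ} {p : V}
    {D : Finset (Finset V)} (hD : D ⊆ {c ∈ F | p ∈ c}) (hDK : ∀ c ∈ D, #c = K) :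
    #(G.neighborFinset p \ D.biUnion (·.erase p)) + #D * K = k + #D := by
  have hsub : D.biUnion (·.erase p) ⊆ G.neighborFinset p := by
    rw [hF.neighborFinset_eq_biUnion]
    exact biUnion_subset_biUnion_of_subset_left _ hD
  have hline : ∀ c ∈ D, #(c.erase p) + 1 = K := fun c hc => by
    rw [card_erase_add_one (mem_filter.1 (hD hc)).2, hDK c hc]
  have hunion : #(D.biUnion (·.erase p)) + #D = #D * K := by
    rw [card_biUnion ((hF.pairwiseDisjoint_erase p).subset (coe_subset.2 hD)), card_eq_sum_ones D,
      ← sum_add_distrib, sum_congr rfl hline, sum_const, smul_eq_mul, ← card_eq_sum_ones]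
  have hcard := card_sdiff_add_card_eq_card hsub
  rw [G.card_neighborFinset_eq_degree, hreg.degree_eq] at hcard
  omega

theorem card_neighborFinset_inter_neighborFinset_sdiff {K e : ℕ} (hK : m * K = k + m)
    (he : m * e = μ) {p q : V} {D : Finset (Finset V)} (hD : D ⊆ {c ∈ F | p ∈ c})
    (hDK : ∀ c ∈ D, #c = K) (hDcard : #D + 1 = m) (hpq : G.Adj p q)
    (hq : q ∉ D.biUnion (·.erase p)) :
    #(G.neighborFinset q ∩ (G.neighborFinset p \ D.biUnion (·.erase p))) + 2 = K := by
  have : Nonempty V := ⟨p⟩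
  have hline : ∀ c ∈ D, #(G.neighborFinset q ∩ c.erase p) + 1 = e := by
    intro c hc
    obtain ⟨hcF, hpc⟩ := mem_filter.1 (hD hc)
    have hqc : q ∉ c := fun hqc =>
      hq (mem_biUnion.2 ⟨c, hc, mem_erase.2 ⟨hpq.ne', hqc⟩⟩)
    have hcount := h.mul_card_neighborFinset_inter_eq (hF.isMaxClique c hcF).prop
      (by rw [hDK c hc, hK]) hqc
    rw [← Nat.eq_of_mul_eq_mul_left (by have := h.two_le; omega) (hcount.trans he.symm),
      inter_erase, card_erase_add_one (by simpa [hpc] using hpq.symm)]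
  have hunion : #(G.neighborFinset q ∩ D.biUnion (·.erase p)) + #D = #D * e := by
    rw [inter_biUnion, card_biUnion, card_eq_sum_ones D, ← sum_add_distrib, sum_congr rfl hline,
      sum_const, smul_eq_mul, ← card_eq_sum_ones]
    exact fun c hc d hd hcd => (hF.pairwiseDisjoint_erase p (hD hc) (hD hd) hcd).mono
      inter_subset_right inter_subset_right
  have hsub : D.biUnion (·.erase p) ⊆ G.neighborFinset p := by
    rw [hF.neighborFinset_eq_biUnion]
    exact biUnion_subset_biUnion_of_subset_left _ hD
  have hsplit := card_inter_add_card_sdiff (G.neighborFinset q ∩ G.neighborFinset p)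
    (D.biUnion (·.erase p))
  rw [inter_assoc, inter_eq_right.2 hsub, inter_sdiff_assoc,
    h.card_common_of_adj hpq.symm] at hsplit
  have hKℓ := h.cast_card_eq hK he
  zify at hsplit hunion hDcard ⊢
  linear_combination hsplit - hunion - hKℓ + (1 - (e : ℤ)) * hDcard

/-- The neighbours of `p` outside the lines in `D` form a single further line. -/
theorem card_lines_le {p : V} {D : Finset (Finset V)} (hD : D ⊆ {c ∈ F | p ∈ c})
    (hDelsarte : ∀ c ∈ D, m * #c = k + m) (hDcard : #D + 1 = m) : #{c ∈ F | p ∈ c} ≤ m := by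
  have : Nonempty V := ⟨p⟩
  have hm := h.two_le
  obtain ⟨c₀, hc₀⟩ : D.Nonempty := card_pos.1 (by omega)
  obtain ⟨K, hc₀K⟩ : ∃ K, #c₀ = K := ⟨_, rfl⟩
  have hK : m * K = k + m := by rw [← hc₀K, hDelsarte c₀ hc₀]
  have hDK : ∀ c ∈ D, #c = K := fun c hc =>
    Nat.eq_of_mul_eq_mul_left (by omega) ((hDelsarte c hc).trans hK.symm)
  obtain ⟨e, he⟩ := h.dvd_mu (hF.isMaxClique c₀ (mem_filter.1 (hD hc₀)).1).prop (hDelsarte c₀ hc₀)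
  set Q := G.neighborFinset p \ D.biUnion (·.erase p) with hQ
  have hQcard : #Q + 1 = K := by
    have hsum : #Q + #D * K = k + #D := card_neighborFinset_sdiff_add hF h.regular hD hDK
    rw [← hDcard, add_mul] at hK
    omega
  have hQadj : ∀ q ∈ Q, Q.erase q ⊆ G.neighborFinset q := by
    intro q hq
    obtain ⟨hpq, hqD⟩ := mem_sdiff.1 hq
    have hcard : #(G.neighborFinset q ∩ Q) + 2 = K :=
      h.card_neighborFinset_inter_neighborFinset_sdiff hF hK he.symm hD hDK hDcard
        ((G.mem_neighborFinset p q).1 hpq) hqD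
    have hsub : G.neighborFinset q ∩ Q ⊆ Q.erase q := fun y hy =>
      mem_erase.2 ⟨fun hyq => by simp [hyq] at hy, (mem_inter.1 hy).2⟩
    rw [← eq_of_subset_of_card_le hsub (by rw [card_erase_of_mem hq]; omega)]
    exact inter_subset_left
  have hclique : G.IsClique (insert p Q : Finset V) := by
    rw [coe_insert, SimpleGraph.isClique_insert]
    refine ⟨fun x hx y hy hxy => ?_, fun y hy _ => ?_⟩
    · exact (G.mem_neighborFinset x y).1 (hQadj x hx (mem_erase.2 ⟨hxy.symm, hy⟩))
    · exact (G.mem_neighborFinset p y).1 (mem_sdiff.1 hy).1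
  have hsub : {c ∈ F | p ∈ c} ⊆ insert (insert p Q) D := by
    intro c hc
    obtain ⟨hcF, hpc⟩ := mem_filter.1 hc
    refine mem_insert.2 (or_iff_not_imp_right.2 fun hcD => ?_)
    have hcQ : c ⊆ insert p Q := by
      rw [subset_insert_iff, hQ]
      refine subset_sdiff.2 ⟨hF.erase_subset_neighborFinset hcF hpc, ?_⟩
      exact (disjoint_biUnion_right _ _ _).2 fun d hd =>
        hF.pairwiseDisjoint_erase p hc (hD hd) fun hcd => hcD (hcd ▸ hd)
    exact hcQ.antisymm ((hF.isMaxClique c hcF).le_of_ge hclique hcQ)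
  exact (card_le_card hsub).trans ((card_insert_le _ _).trans hDcard.le)

theorem card_delsarte_lines_add_two_le {p : V} (hp : #{c ∈ F | p ∈ c} ≠ m) :
    #{c ∈ {c ∈ F | p ∈ c} | m * #c = k + m} + 2 ≤ m := by
  by_contra! hlt
  obtain ⟨D, hD, hDcard⟩ := exists_subset_card_eq (s := {c ∈ {c ∈ F | p ∈ c} | m * #c = k + m})
    (n := m - 1) (by omega)
  refine hp (le_antisymm (h.card_lines_le hF (hD.trans (filter_subset _ _))
    (fun c hc => (mem_filter.1 (hD hc)).2) ?_) (h.le_card_lines hF p))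
  have := h.two_le
  omega

theorem two_mul_le_mul_card_irregular {p : V} (hp : #{c ∈ F | p ∈ c} ≠ m) :
    2 * k ≤ m * #(G.neighborFinset p ∩ ({x | #{c ∈ F | x ∈ c} ≠ m} : Finset V)) := by
  set Fp : Finset (Finset V) := {c ∈ F | p ∈ c} with hFp
  set N : Finset (Finset V) := {c ∈ Fp | ¬ m * #c = k + m}
  have hFp' : ∀ c ∈ Fp, c ∈ F ∧ p ∈ c := fun c => by simp [hFp]
  have hirr : ∑ c ∈ N, (#c - 1) ≤
      #(G.neighborFinset p ∩ ({x | #{c ∈ F | x ∈ c} ≠ m} : Finset V)) := by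
    have hdisj := (hF.pairwiseDisjoint_erase p).subset
      (coe_subset.2 (filter_subset (fun c => ¬ m * #c = k + m) Fp))
    rw [sum_congr rfl fun c hc => (card_erase_of_mem (hFp' c (mem_filter.1 hc).1).2).symm,
      ← card_biUnion hdisj]
    refine card_le_card (biUnion_subset.2 fun c hc y hy => ?_)
    obtain ⟨hc, hcm⟩ := mem_filter.1 hc
    obtain ⟨hcF, hpc⟩ := hFp' c hc
    refine mem_inter.2 ⟨hF.erase_subset_neighborFinset hcF hpc hy, ?_⟩
    simp only [mem_filter_univ]
    exact fun hym => hcm (h.mul_card_eq_of_card_lines_eq hF hym hcF (mem_of_mem_erase hy))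
  have hDelsarte : ∑ c ∈ Fp with m * #c = k + m, m * (#c - 1) ≤
      #{c ∈ Fp | m * #c = k + m} * k := by
    simpa using sum_le_card_nsmul _ _ _ fun c hc =>
      h.mul_card_sub_one_le hF (hFp' c (mem_filter.1 hc).1).1
  have hsum : ∑ c ∈ Fp, m * (#c - 1) = m * k := by
    rw [← mul_sum, h.sum_card_lines_sub_one hF]
  rw [← sum_filter_add_sum_filter_not Fp (fun c => m * #c = k + m), ← mul_sum N] at hsum
  have htwo := Nat.mul_le_mul_right k (h.card_delsarte_lines_add_two_le hF hp)
  have := Nat.mul_le_mul_left m hirr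
  rw [add_mul, ← hFp] at htwo
  omega

/-- The form of `eigenMatrix` would be negative on the set of vertices on more than `m` lines. -/
theorem card_lines_eq_of_mul_card_lines_le (hcard : m * #F ≤ v) (p : V) :
    #{c ∈ F | p ∈ c} = m := by
  by_contra hp
  have : Nonempty V := ⟨p⟩
  set U : Finset V := {x | #{c ∈ F | x ∈ c} ≠ m} with hU
  have hUpos : (0 : ℝ) < #U := mod_cast card_pos.2 ⟨p, by simpa [hU] using hp⟩
  have hUle : (m * #U : ℝ) ≤ v :=
    mod_cast (Nat.mul_le_mul_left m (h.card_irregular_le hF)).trans hcard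
  have hdeg : #U * (2 * k : ℝ) ≤ m * ∑ x ∈ U, (#(G.neighborFinset x ∩ U) : ℝ) := by
    rw [mul_sum, ← nsmul_eq_mul]
    refine card_nsmul_le_sum _ _ _ fun x hx => ?_
    exact_mod_cast h.two_mul_le_mul_card_irregular hF (mem_filter.1 hx).2
  have hform := h.posSemidef_eigenMatrix.dotProduct_mulVec_nonneg (charVec U)
  rw [star_trivial, charVec_dotProduct_eigenMatrix] at hform
  have hJ : m * (μ / (k + m) * #U : ℝ) ≤ k - (ℓ - μ + m) := by
    have hkm := h.k_add_m_pos
    calc m * (μ / (k + m) * #U : ℝ) = μ * (m * #U) / (k + m) := by ring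
      _ ≤ μ * v / (k + m) := by gcongr
      _ = k - (ℓ - μ + m) := by rw [h.mu_mul_card]; field_simp
  have hneg : m * (ℓ - μ + m) - 2 * k + (k - (ℓ - μ + m)) < (0 : ℝ) := by
    have hμ : (0 : ℝ) < μ := mod_cast h.mu_pos
    linarith [h.valency_eq, h.theta_pos]
  have := mul_neg_of_pos_of_neg hUpos hneg
  have := mul_le_mul_of_nonneg_left hJ hUpos.le
  have := mul_nonneg h.m_pos.le hform
  linarith

theorem card_lines_eq {s : ℕ} (hs : ∀ x, #{c ∈ F | x ∈ c} ≤ s) (hbig : ∀ c ∈ F, m * s ≤ #c)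
    (p : V) : #{c ∈ F | p ∈ c} = m := by
  have hspos : 0 < s := by have := (h.le_card_lines hF p).trans (hs p); have := h.two_le; omega
  exact h.card_lines_eq_of_mul_card_lines_le hF
    (h.card ▸ mul_card_le_card_of_card_filter_mem_le hspos hs hbig) p

end IsSRGWithSmallest

end Lines

section KreinAbsolute

open Matrix
open scoped Pointwise

theorem finrank_mul_le {K A : Type*} [Field K] [CommRing A] [Algebra K A] (S T : Submodule K A)
    [Module.Finite K S] [Module.Finite K T] :
    Module.finrank K ↥(S * T) ≤ Module.finrank K S * Module.finrank K T := by
  rw [← Submodule.mulMap_range, ← Module.finrank_tensorProduct]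
  exact LinearMap.finrank_range_le _

theorem rank_hadamard_le {K m n : Type*} [Field K] [Finite m] [Fintype n] (A B : Matrix m n K) :
    (A ⊙ B).rank ≤ A.rank * B.rank := by
  simp only [rank_eq_finrank_span_cols]
  refine (Submodule.finrank_mono (Submodule.span_le.2 ?_)).trans (finrank_mul_le _ _)
  rintro _ ⟨j, rfl⟩
  exact Submodule.mul_mem_mul (Submodule.subset_span ⟨j, rfl⟩) (Submodule.subset_span ⟨j, rfl⟩)

theorem mul_rank_eq_trace {K n : Type*} [Field K] [Fintype n] {M : Matrix n n K} {c : K}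
    (hc : c ≠ 0) (h : M * M = c • M) : c * M.rank = M.trace := by
  classical
  have hidem : IsIdempotentElem (c⁻¹ • toLin' M) := by
    rw [IsIdempotentElem, smul_mul_smul_comm, Module.End.mul_eq_comp, ← toLin'_mul, h, map_smul,
      smul_smul, mul_assoc, inv_mul_cancel₀ hc, mul_one]
  have htrace := (LinearMap.IsIdempotentElem.isProj_range _ hidem).trace
  rw [LinearMap.range_smul _ _ (inv_ne_zero hc), map_smul, trace_toLin'_eq, smul_eq_mul] at htrace
  rw [rank_eq_finrank_range_toLin M (Pi.basisFun K n) (Pi.basisFun K n), toLin_eq_toLin', ← htrace,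
    mul_inv_cancel_left₀ hc]

variable {V : Type*} {G : SimpleGraph V} [DecidableRel G.Adj] {v k ℓ μ m : ℕ}

theorem hadamard_linearComb [DecidableEq V] (a b c a' b' c' : ℝ) :
    (a • (1 : Matrix V V ℝ) + b • G.adjMatrix ℝ + c • allOnes V) ⊙
        (a' • (1 : Matrix V V ℝ) + b' • G.adjMatrix ℝ + c' • allOnes V) =
      (a * a' + a * c' + c * a') • (1 : Matrix V V ℝ) +
        (b * b' + b * c' + c * b') • G.adjMatrix ℝ + (c * c') • allOnes V := by
  ext x y
  by_cases hxy : x = y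
  · simp [allOnes, hxy, add_mul, mul_add]
    ring
  · by_cases hadj : G.Adj x y <;>
      simp [allOnes, SimpleGraph.adjMatrix_apply, hxy, hadj, add_mul, mul_add]
    ring

variable [Fintype V]

theorem one_dotProduct_linearComb_mulVec_one [DecidableEq V] (hG : G.IsSRGWith v k ℓ μ)
    (a b c : ℝ) :
    (1 : V → ℝ) ⬝ᵥ ((a • (1 : Matrix V V ℝ) + b • G.adjMatrix ℝ + c • allOnes V) *ᵥ 1) =
      v * (a + b * k + c * v) := by
  have hJ : allOnes V *ᵥ 1 = fun _ => (v : ℝ) := by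
    ext; simp [allOnes, mulVec, dotProduct, ← hG.card]
  have hA : G.adjMatrix ℝ *ᵥ 1 = fun _ => (k : ℝ) := by
    ext; simp [SimpleGraph.adjMatrix_mulVec_apply, hG.regular.degree_eq]
  simp only [add_mulVec, smul_mulVec, one_mulVec, hJ, hA]
  simp [dotProduct, hG.card, mul_add]

namespace IsSRGWithSmallest

theorem tau_mul_card [Nonempty V] (h : IsSRGWithSmallest G v k ℓ μ m) :
    (μ / (k + m) : ℝ) * v = k - (ℓ - μ + m) := by
  have := h.k_add_m_pos.ne'
  field_simp
  linear_combination h.mu_mul_card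

/-- A Krein condition: the entries of the Hadamard cube of `eigenMatrix` have nonnegative sum. -/
theorem krein [Nonempty V] (h : IsSRGWithSmallest G v k ℓ μ m) {θ τ : ℝ} (hθ : θ = ℓ - μ + m)
    (hτ : τ = μ / (k + m)) :
    k * (1 - τ) * (1 - 2 * τ) ≤ θ * (θ + τ) * (θ + 2 * τ) := by
  classical
  have hv : (0 : ℝ) < v := by rw [← h.card]; exact_mod_cast Fintype.card_pos
  have hE := h.posSemidef_eigenMatrix
  have hsum := ((hE.hadamard hE).hadamard hE).dotProduct_mulVec_nonneg 1
  rw [star_trivial, eigenMatrix, hadamard_linearComb, hadamard_linearComb,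
    one_dotProduct_linearComb_mulVec_one h.toIsSRGWith, ← hθ, ← hτ] at hsum
  have hτv : τ * v = k - θ := by rw [hτ, hθ, h.tau_mul_card]
  have := nonneg_of_mul_nonneg_right hsum hv
  linear_combination this + τ ^ 2 * hτv

theorem card_le_rank_sq [Nonempty V] [DecidableEq V] (h : IsSRGWithSmallest G v k ℓ μ m)
    (hτ : 1 ≤ 2 * (μ / (k + m) : ℝ)) (hτ' : (μ / (k + m) : ℝ) ≤ 1) :
    v ≤ (eigenMatrix G k ℓ μ m).rank ^ 2 := by
  have hE := h.posSemidef_eigenMatrix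
  have hθ := h.theta_pos
  have hpos : (eigenMatrix G k ℓ μ m ⊙ eigenMatrix G k ℓ μ m).PosDef := by
    have hone := (PosDef.one (n := V) (R := ℝ)).smul (mul_pos hθ (add_pos hθ one_pos))
    have hJ := (posSemidef_allOnes (n := V)).smul
      (mul_nonneg (by linarith : (0 : ℝ) ≤ μ / (k + m)) (sub_nonneg.2 hτ'))
    convert (hone.add_posSemidef (hE.smul (sub_nonneg.2 hτ))).add_posSemidef hJ using 1
    rw [eigenMatrix, hadamard_linearComb]
    module
  rw [← h.card, ← rank_of_isUnit _ hpos.isUnit, sq]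
  exact rank_hadamard_le _ _

/-- The absolute bound: the Hadamard square of `eigenMatrix` is invertible, but its rank is at most
the square of the multiplicity of the eigenvalue `-m`. -/
theorem absolute_bound [Nonempty V] (h : IsSRGWithSmallest G v k ℓ μ m)
    (hτ : 1 ≤ 2 * (μ / (k + m) : ℝ)) (hτ' : (μ / (k + m) : ℝ) ≤ 1) :
    (ℓ - μ + 2 * m : ℝ) ^ 2 ≤ v * (ℓ - μ + m + μ / (k + m)) ^ 2 := by
  classical
  have hv : (0 : ℝ) < v := by rw [← h.card]; exact_mod_cast Fintype.card_pos
  have hrank : (v : ℝ) ≤ (eigenMatrix G k ℓ μ m).rank ^ 2 := mod_cast h.card_le_rank_sq hτ hτ'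
  set g : ℝ := ((eigenMatrix G k ℓ μ m).rank : ℝ) with hg
  have htrace : (ℓ - μ + 2 * m) * g = v * (ℓ - μ + m + μ / (k + m)) := by
    rw [hg, mul_rank_eq_trace h.theta_add_m_pos.ne' h.eigenMatrix_mul_self]
    simp [eigenMatrix, allOnes, trace, h.card, mul_add]
  refine le_of_mul_le_mul_left ?_ hv
  calc v * (ℓ - μ + 2 * m : ℝ) ^ 2
      ≤ g ^ 2 * (ℓ - μ + 2 * m) ^ 2 := by gcongr
    _ = ((ℓ - μ + 2 * m) * g) ^ 2 := by ring
    _ = v * (v * (ℓ - μ + m + μ / (k + m)) ^ 2) := by rw [htrace]; ring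

end IsSRGWithSmallest

end KreinAbsolute

section PartialGeometry

universe u

section PartialLinearSpace

variable {P L : Type u} {I : P → L → Prop}
  (hI : ∀ p q : P, p ≠ q → ∀ a b : L, I p a → I q a → I p b → I q b → a = b)
include hI

theorem ncard_lines_meeting_eq_ncard_collinear_points {p : P} {a : L} (hpa : ¬ I p a) :
    {b | I p b ∧ ∃ q, I q b ∧ I q a}.ncard = {q | I q a ∧ ∃ b, I p b ∧ I q b}.ncard := by
  choose q hq using fun b (hb : ∃ q, I q b ∧ I q a) => hb
  have hne : ∀ x, I x a → p ≠ x := by rintro x hxa rfl; exact hpa hxa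
  refine Set.ncard_congr (fun b hb => q b hb.2)
    (fun b hb => ⟨(hq b hb.2).2, b, hb.1, (hq b hb.2).1⟩) ?_ ?_
  · intro b c hb hc hbc
    refine hI p (q b hb.2) (hne _ (hq b hb.2).2) b c hb.1 (hq b hb.2).1 hc.1 ?_
    rw [hbc]
    exact (hq c hc.2).1
  · rintro x ⟨hxa, b, hpb, hxb⟩
    have hb : ∃ x, I x b ∧ I x a := ⟨x, hxb, hxa⟩
    refine ⟨b, ⟨hpb, hb⟩, ?_⟩
    by_contra hne'
    exact hpa (hI (q b hb) x hne' b a (hq b hb).1 hxb (hq b hb).2 hxa ▸ hpb)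

theorem card_filter_pointGraph_adj [Fintype P] [Fintype L] [DecidableEq P] [DecidableRel I]
    [DecidableRel (pointGraph I).Adj] (p : P) (s : P → Prop) [DecidablePred s] :
    #{q | (pointGraph I).Adj p q ∧ s q} = ∑ b with I p b, #{q | q ≠ p ∧ I q b ∧ s q} := by
  rw [← card_biUnion]
  · congr 1
    ext q
    simp only [mem_biUnion, mem_filter, mem_univ, true_and]
    exact ⟨fun ⟨⟨hpq, b, hpb, hqb⟩, hq⟩ => ⟨b, hpb, hpq.symm, hqb, hq⟩,
      fun ⟨b, hpb, hqp, hqb, hq⟩ => ⟨⟨hqp.symm, b, hpb, hqb⟩, hq⟩⟩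
  · intro b hb c hc hbc
    simp only [coe_filter, mem_univ, true_and, Set.mem_ofPred_eq] at hb hc
    rw [Function.onFun, disjoint_filter]
    rintro q - ⟨hqp, hqb, -⟩ ⟨-, hqc, -⟩
    exact hbc (hI q p hqp b c hqb hb hqc hc)

end PartialLinearSpace

namespace IsPartialGeometry

variable {P L : Type u} {I : P → L → Prop} {K R T : ℕ} (h : IsPartialGeometry I K R T)
include h

theorem ncard_collinear_points {p : P} {a : L} (hpa : ¬ I p a) :
    {q | I q a ∧ ∃ b, I p b ∧ I q b}.ncard = T := by
  rw [← ncard_lines_meeting_eq_ncard_collinear_points h.line_unique hpa, h.meeting a p hpa]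

theorem dual : IsPartialGeometry (fun a p => I p a) R K T where
  one_lt_K := h.one_lt_R
  one_lt_R := h.one_lt_K
  T_pos := h.T_pos
  nonempty_points := h.nonempty_lines
  nonempty_lines := h.nonempty_points
  line_unique a b hab p q hpa hpb hqa hqb := by
    by_contra hpq
    exact hab (h.line_unique p q hpq a b hpa hqa hpb hqb)
  order_line := h.order_point
  order_point := h.order_line
  meeting _ _ hpa := by simpa only [and_comm] using h.ncard_collinear_points hpa

theorem exists_not_incident : ∃ p a, ¬ I p a := by
  by_contra! hall
  obtain ⟨p⟩ := h.nonempty_points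
  obtain ⟨q, hqp⟩ : ∃ q, q ≠ p := by
    obtain ⟨a⟩ := h.nonempty_lines
    obtain ⟨q, -, hqp⟩ := Set.exists_ne_of_one_lt_ncard (h.order_line a ▸ h.one_lt_K) p
    exact ⟨q, hqp⟩
  obtain ⟨a⟩ := h.nonempty_lines
  obtain ⟨b, -, hba⟩ := Set.exists_ne_of_one_lt_ncard (h.order_point p ▸ h.one_lt_R) a
  exact hba (h.line_unique q p hqp b a (hall q b) (hall p b) (hall q a) (hall p a))

theorem finite_lines_through (p : P) : {a | I p a}.Finite :=
  Set.finite_of_ncard_pos (h.order_point p ▸ zero_lt_one.trans h.one_lt_R)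

theorem T_le_R : T ≤ R := by
  obtain ⟨p, a, hpa⟩ := h.exists_not_incident
  rw [← h.meeting a p hpa, ← h.order_point p]
  exact Set.ncard_le_ncard (fun b hb => hb.1) (h.finite_lines_through p)

section Counting

theorem card_points_on_line [Fintype P] [DecidableRel I] (a : L) : #{p | I p a} = K := by
  rw [← h.order_line a, ← Set.ncard_coe_finset, coe_filter_univ]

theorem card_lines_through_point [Fintype L] [DecidableRel I] (p : P) : #{a | I p a} = R := by
  rw [← h.order_point p, ← Set.ncard_coe_finset, coe_filter_univ]

variable [Fintype P] [DecidableRel I] {p q : P} {b : L}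

theorem card_filter_ne_and_incident [DecidableEq P] (hpb : I p b) :
    #{x | x ≠ p ∧ I x b} = K - 1 := by
  rw [← h.card_points_on_line b, ← card_erase_of_mem (by simpa using hpb)]
  congr 1
  ext; simp

variable [DecidableRel (pointGraph I).Adj]

theorem card_filter_incident_and_adj (hqb : ¬ I q b) :
    #{x | I x b ∧ (pointGraph I).Adj q x} = T := by
  rw [← h.ncard_collinear_points hqb, ← Set.ncard_coe_finset, coe_filter_univ]
  congr 1
  ext x
  exact and_congr_right fun hx => and_iff_right fun hqx => hqb (hqx ▸ hx)

variable [DecidableEq P]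

theorem card_collinear_of_incident (hpb : I p b) (hqb : I q b) (hpq : p ≠ q) :
    #{x | x ≠ p ∧ I x b ∧ (pointGraph I).Adj q x} = K - 2 := by
  have : ({x | x ≠ p ∧ I x b ∧ (pointGraph I).Adj q x} : Finset P) =
      ({x | x ≠ p ∧ I x b} : Finset P).erase q := by
    ext x
    simp only [mem_filter, mem_univ, true_and, mem_erase]
    exact ⟨fun ⟨hxp, hxb, hqx, _⟩ => ⟨hqx.symm, hxp, hxb⟩,
      fun ⟨hxq, hxp, hxb⟩ => ⟨hxp, hxb, hxq.symm, b, hqb, hxb⟩⟩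
  rw [this, card_erase_of_mem (by simpa using ⟨hpq.symm, hqb⟩), h.card_filter_ne_and_incident hpb]
  rfl

theorem card_collinear_of_adj (hpb : I p b) (hqb : ¬ I q b) (hpq : (pointGraph I).Adj p q) :
    #{x | x ≠ p ∧ I x b ∧ (pointGraph I).Adj q x} = T - 1 := by
  rw [← h.card_filter_incident_and_adj hqb, ← card_erase_of_mem (by simpa using ⟨hpb, hpq.symm⟩)]
  congr 1
  ext; simp

theorem card_collinear_of_not_adj (hqb : ¬ I q b) (hpq : ¬ (pointGraph I).Adj p q) :
    #{x | x ≠ p ∧ I x b ∧ (pointGraph I).Adj q x} = T := by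
  rw [← h.card_filter_incident_and_adj hqb]
  congr 1
  ext x
  simp only [mem_filter, mem_univ, true_and, and_iff_right_iff_imp]
  rintro ⟨-, hqx⟩ rfl
  exact hpq hqx.symm

end Counting

theorem isSRGWith [Fintype P] [Finite L] [DecidableRel (pointGraph I).Adj] :
    (pointGraph I).IsSRGWith (Fintype.card P) (R * (K - 1)) (K - 2 + (R - 1) * (T - 1))
      (R * T) := by
  classical
  have := Fintype.ofFinite L
  have hcommon : ∀ p q, Fintype.card ((pointGraph I).commonNeighbors p q) =
      ∑ b with I p b, #{x | x ≠ p ∧ I x b ∧ (pointGraph I).Adj q x} := by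
    intro p q
    rw [← card_filter_pointGraph_adj h.line_unique, Fintype.card_subtype]
    rfl
  refine ⟨rfl, fun p => ?_, fun p q hpq => ?_, fun p q hne hpq => ?_⟩
  · have hdeg := card_filter_pointGraph_adj h.line_unique p fun _ => True
    simp only [and_true] at hdeg
    rw [← SimpleGraph.card_neighborFinset_eq_degree, SimpleGraph.neighborFinset_eq_filter, hdeg,
      sum_const_nat fun b hb => h.card_filter_ne_and_incident (by simpa using hb),
      h.card_lines_through_point]
  · obtain ⟨hne, a, hpa, hqa⟩ := hpq
    have ha : a ∈ ({b | I p b} : Finset L) := by simpa using hpa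
    rw [hcommon, ← add_sum_erase _ _ ha, h.card_collinear_of_incident hpa hqa hne, sum_const_nat,
      card_erase_of_mem ha, h.card_lines_through_point]
    intro b hb
    simp only [mem_erase, mem_filter, mem_univ, true_and] at hb
    exact h.card_collinear_of_adj hb.2
      (fun hqb => hb.1 (h.line_unique p q hne b a hb.2 hqb hpa hqa)) ⟨hne, a, hpa, hqa⟩
  · rw [hcommon, sum_const_nat, h.card_lines_through_point]
    intro b hb
    simp only [mem_filter, mem_univ, true_and] at hb
    exact h.card_collinear_of_not_adj (fun hqb => hpq ⟨hne, b, hb, hqb⟩) hpq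

theorem cast_valency : ((R * (K - 1) : ℕ) : ℝ) = R * (K - 1) := by
  have := h.one_lt_K
  push_cast [Nat.cast_sub this.le]
  ring

theorem cast_ell : ((K - 2 + (R - 1) * (T - 1) : ℕ) : ℝ) = K - 2 + (R - 1) * (T - 1) := by
  push_cast [Nat.cast_sub h.one_lt_R.le, Nat.cast_sub h.T_pos, Nat.cast_sub h.one_lt_K]
  ring

theorem card_points_mul [Fintype P] [Finite L] :
    (Fintype.card P : ℝ) * T = K * (T + (R - 1) * (K - 1)) := by
  classical
  have := h.nonempty_points
  have hR : (R : ℝ) ≠ 0 := by exact_mod_cast (zero_lt_one.trans h.one_lt_R).ne'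
  have hcard := mu_mul_card_eq h.isSRGWith
  rw [h.cast_valency, h.cast_ell, Nat.cast_mul] at hcard
  refine mul_left_cancel₀ hR ?_
  linear_combination hcard

theorem isSRGWithSmallest [Fintype P] [Finite L] [DecidableRel (pointGraph I).Adj]
    (hT : T + 2 ≤ K) :
    IsSRGWithSmallest (pointGraph I) (Fintype.card P) (R * (K - 1))
      (K - 2 + (R - 1) * (T - 1)) (R * T) R where
  toIsSRGWith := h.isSRGWith
  mu_pos := Nat.mul_pos (zero_lt_one.trans h.one_lt_R) h.T_pos
  mu_lt := by
    have hT' : (T : ℝ) + 2 ≤ K := by exact_mod_cast hT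
    rw [← Nat.cast_lt (α := ℝ), Nat.cast_add, h.cast_ell, Nat.cast_mul]
    linarith
  two_le := h.one_lt_R
  valency_eq := by
    rw [h.cast_valency, h.cast_ell, Nat.cast_mul]
    ring

theorem mu_div_valency_add :
    ((R * T : ℕ) / ((R * (K - 1) : ℕ) + R) : ℝ) = T / K := by
  have hR : (R : ℝ) ≠ 0 := by exact_mod_cast (zero_lt_one.trans h.one_lt_R).ne'
  rw [h.cast_valency, Nat.cast_mul, ← mul_add_one, sub_add_cancel, mul_div_mul_left _ _ hR]

section Bounds

variable [Finite P] [Finite L] (hT : T + 2 ≤ K)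
include hT

theorem krein : (R : ℝ) * (K - 2 * T) ≤ (K - 1 - T) * (K * (K - 1 - T) + 2 * T) := by
  classical
  have := Fintype.ofFinite P
  have := h.nonempty_points
  have hT' : (T : ℝ) + 2 ≤ K := by exact_mod_cast hT
  have hK : (0 : ℝ) < K := by linarith [T.cast_nonneg (α := ℝ)]
  have hkrein := (h.isSRGWithSmallest hT).krein (θ := K - 1 - T)
    (by rw [h.cast_ell, Nat.cast_mul]; ring) h.mu_div_valency_add.symm
  rw [h.cast_valency] at hkrein
  have hpos : 0 < ((K : ℝ) - 1) * (K - T) / K ^ 2 :=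
    div_pos (mul_pos (by linarith [T.cast_nonneg (α := ℝ)]) (by linarith)) (by positivity)
  refine le_of_mul_le_mul_left ?_ hpos
  calc ((K : ℝ) - 1) * (K - T) / K ^ 2 * (R * (K - 2 * T))
      = R * (K - 1) * (1 - T / K) * (1 - 2 * (T / K)) := by field_simp
    _ ≤ _ := hkrein
    _ = _ := by field_simp; ring

theorem absolute_bound (hKT : K ≤ 2 * T) :
    (T * K * (R + (K - 1 - T)) ^ 2 : ℝ) ≤
      (T + (R - 1) * (K - 1)) * ((K - 1) * (K - T)) ^ 2 := by
  classical
  have := Fintype.ofFinite P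
  have := h.nonempty_points
  have hT' : (T : ℝ) + 2 ≤ K := by exact_mod_cast hT
  have hKT' : (K : ℝ) ≤ 2 * T := by exact_mod_cast hKT
  have hK : (0 : ℝ) < K := by linarith [T.cast_nonneg (α := ℝ)]
  have habs := (h.isSRGWithSmallest hT).absolute_bound
    (by rwa [h.mu_div_valency_add, ← mul_div_assoc, one_le_div hK])
    (by rw [h.mu_div_valency_add, div_le_one hK]; linarith)
  rw [h.mu_div_valency_add, h.cast_ell, Nat.cast_mul] at habs
  calc (T * K * (R + (K - 1 - T)) ^ 2 : ℝ)
      = T * K * (K - 2 + (R - 1) * (T - 1) - R * T + 2 * R) ^ 2 := by ring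
    _ ≤ T * K * (Fintype.card P * (K - 2 + (R - 1) * (T - 1) - R * T + R + T / K) ^ 2) := by
      gcongr
    _ = (Fintype.card P * T) * ((K - 1) * (K - T)) ^ 2 / K := by field_simp; ring
    _ = _ := by rw [h.card_points_mul]; field_simp

theorem R_le_of_two_mul_lt (hTK : 2 * T < K) : R ≤ 2 * K ^ 2 * T := by
  have hT₁ : (1 : ℝ) ≤ T := by exact_mod_cast h.T_pos
  obtain ⟨d, rfl⟩ := Nat.exists_eq_add_of_lt hTK
  have hkrein := h.krein hT
  push_cast at hkrein
  have hd : (0 : ℝ) < d + 1 := by positivity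
  have hmul : (d + T : ℝ) * (d + T + 1) ≤ 2 * (2 * T + d + 1) * T * (d + 1) := by
    nlinarith [mul_nonneg d.cast_nonneg (sub_nonneg.2 hT₁), d.cast_nonneg (α := ℝ)]
  rw [← Nat.cast_le (α := ℝ)]
  push_cast
  refine le_of_mul_le_mul_right ?_ hd
  calc (R * (d + 1) : ℝ)
      ≤ (d + T) * ((2 * T + d + 1) * (d + T) + 2 * T) := by linear_combination hkrein
    _ ≤ (d + T) * ((2 * T + d + 1) * (d + T) + (2 * T + d + 1)) := by gcongr; linarith
    _ = (2 * T + d + 1) * ((d + T) * (d + T + 1)) := by ring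
    _ ≤ (2 * T + d + 1) * (2 * (2 * T + d + 1) * T * (d + 1)) := by gcongr
    _ = _ := by ring

theorem R_le_of_le_two_mul (hKT : K ≤ 2 * T) : R ≤ K ^ 2 * T := by
  have hT' : (T : ℝ) + 2 ≤ K := by exact_mod_cast hT
  have hKT' : (K : ℝ) ≤ 2 * T := by exact_mod_cast hKT
  have hR : (1 : ℝ) < R := by exact_mod_cast h.one_lt_R
  have hT₁ : (1 : ℝ) ≤ T := by exact_mod_cast h.T_pos
  have hs : (0 : ℝ) < R + (K - 1 - T) := by linarith
  have hle : (T + (R - 1) * (K - 1) : ℝ) ≤ K * (R + (K - 1 - T)) := by nlinarith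
  have hprod : (0 : ℝ) ≤ (K - 1) * (K - T) := mul_nonneg (by linarith) (by linarith)
  have hTs : (T * (R + (K - 1 - T)) : ℝ) ≤ T * (K ^ 2 * T) := by
    refine le_of_mul_le_mul_left ?_ (mul_pos (by linarith : (0 : ℝ) < K) hs)
    calc (K * (R + (K - 1 - T)) * (T * (R + (K - 1 - T))) : ℝ)
        = T * K * (R + (K - 1 - T)) ^ 2 := by ring
      _ ≤ (T + (R - 1) * (K - 1)) * ((K - 1) * (K - T)) ^ 2 := h.absolute_bound hT hKT
      _ ≤ K * (R + (K - 1 - T)) * (K * T) ^ 2 := by gcongr <;> linarith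
      _ = _ := by ring
  have := le_of_mul_le_mul_left hTs (zero_lt_one.trans_le hT₁)
  rw [← Nat.cast_le (α := ℝ)]
  push_cast
  linarith

theorem R_le : R ≤ 2 * K ^ 2 * T := by
  rcases lt_or_ge (2 * T) K with hTK | hKT
  · exact h.R_le_of_two_mul_lt hT hTK
  · have := h.R_le_of_le_two_mul hT hKT
    lia

end Bounds

end IsPartialGeometry

end PartialGeometry

section PartialGeometryGraphs

universe u

variable {P L : Type u} {I : P → L → Prop} {K R T : ℕ}

namespace IsPartialGeometry

theorem isCollinearityGraph (h : IsPartialGeometry I K R T) :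
    IsCollinearityGraph (pointGraph I) K R T :=
  ⟨P, L, I, h, ⟨SimpleGraph.Iso.refl⟩⟩

section Dual

variable (h : IsPartialGeometry I K R R)
include h

theorem lines_meet (a b : L) : ∃ p, I p a ∧ I p b := by
  obtain ⟨p, hpb⟩ : {p | I p b}.Nonempty :=
    Set.nonempty_of_ncard_ne_zero (h.order_line b ▸ (zero_lt_one.trans h.one_lt_K).ne')
  by_cases hpa : I p a
  · exact ⟨p, hpa, hpb⟩
  · have hall : {c | I p c ∧ ∃ q, I q c ∧ I q a} = {c | I p c} :=
      Set.eq_of_subset_of_ncard_le (fun c hc => hc.1)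
        (by rw [h.meeting a p hpa, h.order_point p]) (h.finite_lines_through p)
    obtain ⟨-, q, hqb, hqa⟩ : b ∈ {c | I p c ∧ ∃ q, I q c ∧ I q a} := hall ▸ hpb
    exact ⟨q, hqa, hqb⟩

theorem card_lines [Finite P] [Fintype L] : Fintype.card L = R + (K - 1) * (R - 1) := by
  have hR : (R : ℝ) ≠ 0 := by exact_mod_cast (zero_lt_one.trans h.one_lt_R).ne'
  have hcard := h.dual.card_points_mul
  rw [mul_comm] at hcard
  rw [← Nat.cast_inj (R := ℝ), mul_left_cancel₀ hR hcard]
  push_cast [Nat.cast_sub h.one_lt_R.le, Nat.cast_sub h.one_lt_K.le]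
  rfl

theorem isBlockGraph [Finite P] [Finite L] :
    IsBlockGraph (pointGraph I) (R + (K - 1) * (R - 1)) R 1 := by
  refine ⟨L, P, fun a p => I p a, ?_, ⟨SimpleGraph.Iso.refl⟩⟩
  refine ⟨h.one_lt_R, Nat.le_add_right _ _, ?_, h.order_point, fun a b hab => ?_⟩
  · have := Fintype.ofFinite L
    rw [Nat.card_eq_fintype_card, h.card_lines]
  · obtain ⟨p, hpa, hpb⟩ := h.lines_meet a b
    refine Set.ncard_eq_one.2 ⟨p, Set.eq_singleton_iff_unique_mem.2 ⟨⟨hpa, hpb⟩, ?_⟩⟩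
    rintro q ⟨hqa, hqb⟩
    by_contra hqp
    exact hab (h.line_unique q p hqp a b hqa hpa hqb hpb)

end Dual

end IsPartialGeometry

/-- Parallelism of lines: two lines are parallel if they are equal or share no point. -/
def Parallel (I : P → L → Prop) (a b : L) : Prop := a = b ∨ ¬ ∃ p, I p a ∧ I p b

theorem Parallel.symm {a b : L} (hab : Parallel I a b) : Parallel I b a :=
  hab.imp Eq.symm fun hab ⟨p, hpb, hpa⟩ => hab ⟨p, hpa, hpb⟩

theorem Parallel.eq_of_incident {a b : L} (hab : Parallel I a b) {p : P} (hpa : I p a)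
    (hpb : I p b) : a = b :=
  hab.resolve_right (not_not.2 ⟨p, hpa, hpb⟩)

namespace IsPartialGeometry

variable (h : IsPartialGeometry I K R T) (hT : T + 1 = R)
include h hT

theorem existsUnique_parallel (p : P) (a : L) : ∃! b, I p b ∧ Parallel I b a := by
  by_cases hpa : I p a
  · exact ⟨a, ⟨hpa, Or.inl rfl⟩, fun b hb => hb.2.eq_of_incident hb.1 hpa⟩
  · have hfin := h.finite_lines_through p
    have hone : ({b | I p b} \ {b | I p b ∧ ∃ q, I q b ∧ I q a}).ncard = 1 := by
      rw [Set.ncard_sdiff (fun b hb => hb.1) (hfin.subset fun b hb => hb.1), h.order_point,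
        h.meeting a p hpa]
      lia
    obtain ⟨b, hb⟩ := Set.ncard_eq_one.1 hone
    have hiff : ∀ c, I p c ∧ Parallel I c a ↔ c = b := by
      intro c
      rw [← Set.mem_singleton_iff, ← hb]
      refine ⟨fun ⟨hpc, hca⟩ => ⟨hpc, fun ⟨_, q, hqc, hqa⟩ => ?_⟩,
        fun ⟨hpc, hc⟩ => ⟨hpc, Or.inr fun hq => hc ⟨hpc, hq⟩⟩⟩
      exact hpa (hca.eq_of_incident hqc hqa ▸ hpc)
    exact ⟨b, (hiff b).2 rfl, fun c hc => (hiff c).1 hc⟩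

theorem parallel_trans {a b c : L} (hab : Parallel I a b) (hbc : Parallel I b c) :
    Parallel I a c := by
  rw [Parallel, or_iff_not_imp_right, not_not]
  rintro ⟨p, hpa, hpc⟩
  exact (h.existsUnique_parallel hT p b).unique ⟨hpa, hab⟩ ⟨hpc, hbc.symm⟩

theorem card_points [Fintype P] [Finite L] : Fintype.card P = K ^ 2 := by
  have hT₀ : (T : ℝ) ≠ 0 := by exact_mod_cast h.T_pos.ne'
  have hR : (R : ℝ) = T + 1 := by exact_mod_cast hT.symm
  rw [← Nat.cast_inj (R := ℝ)]
  refine mul_right_cancel₀ hT₀ ?_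
  rw [h.card_points_mul, hR]
  push_cast
  ring

theorem card_parallel_class [Finite P] [Finite L] (a : L) :
    Nat.card {b // Parallel I b a} = K := by
  classical
  have := Fintype.ofFinite P
  have := Fintype.ofFinite L
  rw [Nat.card_eq_fintype_card, Fintype.card_subtype]
  have hcount := card_mul_eq_card_mul (s := univ) (t := ({b | Parallel I b a} : Finset L)) I
    (m := 1) (n := K) (fun p _ => ?_) fun b _ => h.card_points_on_line b
  · rw [mul_one, card_univ, h.card_points hT, sq] at hcount
    exact (Nat.eq_of_mul_eq_mul_right (zero_lt_one.trans h.one_lt_K) hcount).symm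
  · obtain ⟨b, ⟨hpb, hba⟩, hunique⟩ := h.existsUnique_parallel hT p a
    refine card_eq_one.2 ⟨b, eq_singleton_iff_unique_mem.2 ⟨?_, fun c hc => ?_⟩⟩
    · simpa [bipartiteAbove] using ⟨hba, hpb⟩
    · simp only [bipartiteAbove, mem_filter, mem_univ, true_and] at hc
      exact hunique c hc.symm

theorem exists_labelling [Finite P] [Finite L] (a : L) :
    ∃ x : P → Fin K, ∀ p q, x p = x q ↔ ∃ b, I p b ∧ I q b ∧ Parallel I b a := by
  choose b hb hunique using fun p => h.existsUnique_parallel hT p a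
  let e : {b // Parallel I b a} ≃ Fin K := Finite.equivFinOfCardEq (h.card_parallel_class hT a)
  refine ⟨fun p => e ⟨b p, (hb p).2⟩, fun p q => ?_⟩
  rw [e.apply_eq_iff_eq, Subtype.mk.injEq]
  refine ⟨fun hpq => ⟨b p, (hb p).1, hpq ▸ (hb q).1, (hb p).2⟩, ?_⟩
  rintro ⟨c, hpc, hqc, hca⟩
  rw [← hunique p c ⟨hpc, hca⟩, ← hunique q c ⟨hqc, hca⟩]

theorem exists_parallel_representatives :
    ∃ d : Fin R → L, (∀ i j, Parallel I (d i) (d j) → i = j) ∧ ∀ a, ∃ i, Parallel I a (d i) := by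
  obtain ⟨p⟩ := h.nonempty_points
  have := (h.finite_lines_through p).to_subtype
  let e : {a | I p a} ≃ Fin R := Finite.equivFinOfCardEq (h.order_point p)
  refine ⟨fun i => e.symm i, fun i j hij => ?_, fun a => ?_⟩
  · exact e.symm.injective (Subtype.ext (hij.eq_of_incident (e.symm i).2 (e.symm j).2))
  · obtain ⟨b, ⟨hpb, hba⟩, -⟩ := h.existsUnique_parallel hT p a
    exact ⟨e ⟨b, hpb⟩, by simpa using hba.symm⟩

theorem exists_coordinates [Finite P] [Finite L] :
    ∃ x : Fin R → P → Fin K, (∀ i j, i ≠ j → Function.Injective fun p => (x i p, x j p)) ∧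
      ∀ p q, (∃ i, x i p = x i q) ↔ ∃ a, I p a ∧ I q a := by
  obtain ⟨d, hd, hd'⟩ := h.exists_parallel_representatives hT
  choose x hx using fun i => h.exists_labelling hT (d i)
  refine ⟨x, fun i j hij p q hpq => ?_, fun p q => ⟨fun ⟨i, hi⟩ => ?_, fun ⟨a, hpa, hqa⟩ => ?_⟩⟩
  · simp only [Prod.mk.injEq, hx] at hpq
    obtain ⟨⟨a, hpa, hqa, hai⟩, b, hpb, hqb, hbj⟩ := hpq
    by_contra hne
    obtain rfl := h.line_unique p q hne a b hpa hqa hpb hqb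
    exact hij (hd i j (h.parallel_trans hT hai.symm hbj))
  · obtain ⟨a, hpa, hqa, -⟩ := (hx i p q).1 hi
    exact ⟨a, hpa, hqa⟩
  · obtain ⟨i, hai⟩ := hd' a
    exact ⟨i, (hx i p q).2 ⟨a, hpa, hqa, hai⟩⟩

theorem isLatinSquareGraph [Finite P] [Finite L] : IsLatinSquareGraph (pointGraph I) R K := by
  have := Fintype.ofFinite P
  obtain ⟨x, hinj, hx⟩ := h.exists_coordinates hT
  let e : P ≃ Fin (K ^ 2) := Fintype.equivFinOfCardEq (h.card_points hT)
  refine ⟨fun i c => x i (e.symm c), fun i j hij => (hinj i j hij).comp e.symm.injective,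
    ⟨⟨e, fun {p q} => ?_⟩⟩⟩
  simp only [columnGraph, pointGraph, e.symm_apply_apply, hx, ne_eq, e.apply_eq_iff_eq]

end IsPartialGeometry

end PartialGeometryGraphs

section LargeLambda

open Matrix

universe u

theorem exists_adj_adj_not_adj {V : Type*} {G : SimpleGraph V} (hc : G.Connected) (ht : G ≠ ⊤) :
    ∃ x y z, G.Adj x y ∧ G.Adj y z ∧ ¬ G.Adj x z ∧ x ≠ z := by
  obtain ⟨x, z, hxz, hn⟩ := SimpleGraph.ne_top_iff_exists_not_adj.1 ht
  obtain ⟨p, hp⟩ := hc.exists_walk_length_eq_dist x z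
  exact p.exists_adj_adj_not_adj_ne hp (hc.one_lt_dist_of_ne_of_not_adj hxz hn)

/-- The incidence structure with the elements of `V` as points and the members of `F` as lines. -/
def lineIncidence {V : Type u} (F : Finset (Finset V)) (p : V) (c : F) : Prop :=
  p ∈ c.1

theorem IsLineSystem.eq_pointGraph {V : Type u} {G : SimpleGraph V} {F : Finset (Finset V)}
    (hF : IsLineSystem G F) : G = pointGraph (lineIncidence F) := by
  ext p q
  refine ⟨fun hpq => ?_, fun ⟨hne, c, hp, hq⟩ => (hF.isMaxClique c c.2).adj hp hq hne⟩
  obtain ⟨c, hc, hp, hq⟩ := hF.cover p q hpq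
  exact ⟨hpq.ne, ⟨c, hc⟩, hp, hq⟩

variable {V : Type u} [Fintype V] {G : SimpleGraph V} [DecidableRel G.Adj]
  {F : Finset (Finset V)} {v k ℓ μ m : ℕ}

theorem sq_eq_of_hasEigenvalue [DecidableEq V] (hG : G.IsSRGWith v k ℓ μ) {r : ℝ} (hr : r ≠ k)
    (h : Module.End.HasEigenvalue (toLin' (G.adjMatrix ℝ)) r) :
    r ^ 2 = k - μ + (ℓ - μ) * r := by
  obtain ⟨w, hw⟩ := h.exists_hasEigenvector
  have hA : G.adjMatrix ℝ *ᵥ w = r • w := hw.apply_eq_smul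
  have hJ : allOnes V *ᵥ w = 0 := by
    have hkr := congrArg (· *ᵥ w) (allOnes_mul_adjMatrix hG.regular)
    simp only [← mulVec_mulVec, hA, mulVec_smul, smul_mulVec] at hkr
    rw [← sub_eq_zero, ← sub_smul] at hkr
    exact (smul_eq_zero.1 hkr).resolve_left (sub_ne_zero.2 hr)
  have hAA := congrArg (· *ᵥ w) (adjMatrix_mul_self hG)
  simp only [← mulVec_mulVec, hA, hJ, mulVec_smul, smul_mulVec,
    add_mulVec, one_mulVec, smul_zero, add_zero, smul_smul, ← add_smul] at hAA
  rw [sq]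
  exact smul_left_injective ℝ (M := V → ℝ) hw.2 hAA

section Parameters

variable (hG : G.IsSRGWith v k ℓ μ) (hc : G.Connected) (ht : G ≠ ⊤)
include hG hc ht

theorem mu_pos_of_connected : 0 < μ := by
  obtain ⟨x, y, z, hxy, hyz, hn, hxz⟩ := exists_adj_adj_not_adj hc ht
  rw [← hG.of_not_adj hxz hn]
  exact Fintype.card_pos_iff.2 ⟨⟨y, hxy, hyz.symm⟩⟩

theorem add_two_le_valency : ℓ + 2 ≤ k := by
  classical
  obtain ⟨x, y, z, hxy, hyz, hn, hxz⟩ := exists_adj_adj_not_adj hc ht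
  have hsub : insert x (insert z (G.neighborFinset x ∩ G.neighborFinset y)) ⊆
      G.neighborFinset y := by
    simp [insert_subset_iff, hxy.symm, hyz, inter_subset_right]
  have hcard := card_le_card hsub
  rwa [card_insert_of_notMem (by simp [hxz]), card_insert_of_notMem (by simp [hn]),
    card_neighborFinset_inter, hG.of_adj x y hxy, SimpleGraph.card_neighborFinset_eq_degree,
    hG.regular y] at hcard

theorem isSRGWithSmallest_of_hasEigenvalue [DecidableEq V] (hm : 0 < m)
    (hev : Module.End.HasEigenvalue (toLin' (G.adjMatrix ℝ)) (-(m : ℝ)))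
    (hf : f m μ < ℓ) : IsSRGWithSmallest G v k ℓ μ m := by
  have hμ := mu_pos_of_connected hG hc ht
  have hk : (k : ℝ) = μ + m * (ℓ - μ + m) := by
    have hm' : (0 : ℝ) < m := mod_cast hm
    have hne : -(m : ℝ) ≠ k := by linarith [k.cast_nonneg (α := ℝ)]
    linear_combination -sq_eq_of_hasEigenvalue hG hne hev
  have hm₂ : 2 ≤ m := by
    by_contra! hlt
    obtain rfl : m = 1 := by omega
    have hkℓ := add_two_le_valency hG hc ht
    have hk' : (k : ℝ) = (ℓ + 1 : ℕ) := by rw [hk]; push_cast; ring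
    rw [Nat.cast_inj] at hk'
    omega
  have hμℓ : μ ≤ ℓ := by
    have hμ' : (1 : ℝ) ≤ μ := mod_cast hμ
    have hm' : (2 : ℝ) ≤ m := mod_cast hm₂
    rw [f] at hf
    have : (μ : ℝ) ≤ ℓ := by nlinarith
    exact_mod_cast this
  exact ⟨hG, hμ, by omega, hm₂, hk⟩

end Parameters

namespace IsSRGWithSmallest

theorem sub_four_lt_of_f_lt {X : ℕ} (hf : f m (X + 1) < ℓ) :
    8 / 3 * m * X - 2 / 3 * X + 3 * m - 4 < (ℓ : ℝ) := by
  rw [f] at hf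
  push_cast at hf
  linarith

/-- A claw with `⌊4m/3⌋ + 1` leaves would violate `IsClaw.card_mul_le`. -/
theorem card_claw_le (h : IsSRGWithSmallest G v k ℓ μ m) (hf : f m μ < ℓ) {x : V}
    {I : Finset V} (hI : IsClaw G x I) : #I ≤ 4 * m / 3 := by
  classical
  by_contra! hlt
  obtain ⟨J, hJI, hJ⟩ := exists_subset_card_eq (show 4 * m / 3 + 1 ≤ #I from hlt)
  obtain ⟨X, rfl⟩ := Nat.exists_eq_add_one.2 h.mu_pos
  have hbound := (hI.subset hJI).card_mul_le (h.regular x).le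
    (fun _ _ => h.card_common_of_adj) fun _ _ hne hn => (h.card_common_of_not_adj hne hn).le
  set σ := #J
  have hbound' : (σ * (ℓ + 1) : ℝ) ≤ k + σ * (σ - 1) / 2 * X := by
    rw [← Nat.cast_choose_two]
    exact_mod_cast hbound
  have hσ₁ : (4 * m + 1 : ℝ) ≤ 3 * σ := by exact_mod_cast (by omega : 4 * m + 1 ≤ 3 * σ)
  have hσ₂ : (3 * σ : ℝ) ≤ 4 * m + 3 := by exact_mod_cast (by omega : 3 * σ ≤ 4 * m + 3)
  have hm : (2 : ℝ) ≤ m := mod_cast h.two_le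
  have hk := h.valency_eq
  push_cast at hk
  have hℓ : (σ - m : ℝ) * (8 / 3 * m * X - 2 / 3 * X + 3 * m - 3) < (σ - m) * (ℓ + 1) :=
    mul_lt_mul_of_pos_left (by linarith [sub_four_lt_of_f_lt hf]) (by linarith)
  have hconst : (m - 1 : ℝ) ^ 2 ≤ (σ - m) * (3 * m - 3) := by nlinarith
  have hcoeff : (0 : ℝ) ≤ (σ - m) * (8 / 3 * m - 2 / 3) + (m - 1) - σ * (σ - 1) / 2 := by nlinarith
  have := mul_nonneg hcoeff X.cast_nonneg
  linarith

variable [DecidableEq V]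

section LineSystem

variable (h : IsSRGWithSmallest G v k ℓ μ m) (hF : IsLineSystem G F)
include h hF

/-- There are too few lines for every vertex to be on more than `m` of them. A vertex on exactly
`m` lines is on a clique that attains the Delsarte bound. -/
theorem dvd_mu_of_two_mul_le_card [Nonempty V] {s : ℕ}
    (hs : ∀ x, #{c ∈ F | x ∈ c} ≤ s) (hbig : ∀ c ∈ F, 2 * s ≤ #c) : m ∣ μ := by
  have hm := h.two_le
  obtain ⟨x⟩ := ‹Nonempty V›
  have hspos : 0 < s := (zero_lt_two.trans_le hm).trans_le ((h.le_card_lines hF x).trans (hs x))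
  have hFcard := mul_card_le_card_of_card_filter_mem_le hspos hs hbig
  obtain ⟨p, hp⟩ : ∃ p, #{c ∈ F | p ∈ c} = m := by
    by_contra! hall
    have hirr := h.card_irregular_le hF
    rw [filter_true_of_mem fun x _ => hall x, card_univ] at hirr
    have := Fintype.card_pos_iff.2 ⟨x⟩
    omega
  obtain ⟨c, hc⟩ := card_pos.1 (hp.symm ▸ zero_lt_two.trans_le hm)
  obtain ⟨hcF, hpc⟩ := mem_filter.1 hc
  exact h.dvd_mu (hF.isMaxClique c hcF).prop (h.mul_card_eq_of_card_lines_eq hF hp hcF hpc)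

end LineSystem

theorem exists_isLineSystem_card_eq [Nonempty V] (h : IsSRGWithSmallest G v k ℓ μ m)
    (hf : f m μ < ℓ) : ∃ F, IsLineSystem G F ∧ ∀ p, #{c ∈ F | p ∈ c} = m := by
  have hclaw := fun x I => h.card_claw_le hf (x := x) (I := I)
  have hs : 3 * (4 * m / 3) ≤ 4 * m := Nat.mul_div_le _ _
  set s := 4 * m / 3
  obtain ⟨X, rfl⟩ := Nat.exists_eq_add_one.2 h.mu_pos
  have hm : (2 : ℝ) ≤ m := mod_cast h.two_le
  have hℓ := sub_four_lt_of_f_lt hf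
  have hs' : (3 * s : ℝ) ≤ 4 * m := mod_cast hs
  have hsX : (3 * s * X : ℝ) ≤ 4 * m * X := by gcongr
  have hmX : (0 : ℝ) ≤ m * X := by positivity
  obtain ⟨F, hF, hbig, hFs⟩ := exists_isLineSystem (fun _ _ => h.card_common_of_adj)
    (fun _ _ hne hn => (h.card_common_of_not_adj hne hn).le) (by
      have : (2 * s * X : ℝ) < ℓ + 1 + X := by linarith
      exact_mod_cast this) hclaw
  have hbig' : ∀ c ∈ F, (4 / 3 * m * X + X / 3 + 3 * m - 2 : ℝ) < #c := fun c hc => by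
    have : (ℓ + 2 + X : ℝ) ≤ #c + s * X := by exact_mod_cast hbig c hc
    linarith
  have hdvd := h.dvd_mu_of_two_mul_le_card hF hFs fun c hc => by
    have : (3 * m : ℝ) < #c + 2 := by linarith [hbig' c hc]
    have : 3 * m < #c + 2 := by exact_mod_cast this
    omega
  have hmμ : (m : ℝ) ≤ X + 1 := by exact_mod_cast Nat.le_of_dvd h.mu_pos hdvd
  refine ⟨F, hF, h.card_lines_eq hF hFs fun c hc => ?_⟩
  have : (m * s : ℝ) ≤ #c := by nlinarith [hbig' c hc]
  exact_mod_cast this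

end IsSRGWithSmallest

theorem IsSRGWithSmallest.isPartialGeometry [Nonempty V] [DecidableEq V]
    (h : IsSRGWithSmallest G v k ℓ μ m) (hF : IsLineSystem G F)
    (hD : ∀ p, #{c ∈ F | p ∈ c} = m) {K T : ℕ} (hK : m * K = k + m) (hT : m * T = μ) :
    IsPartialGeometry (lineIncidence F) K m T := by
  have hm : 0 < m := zero_lt_two.trans_le h.two_le
  have hcard : ∀ c ∈ F, m * #c = k + m := fun c hc => by
    obtain ⟨p, hp⟩ := (hF.isMaxClique c hc).nonempty
    exact h.mul_card_eq_of_card_lines_eq hF (hD p) hc hp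
  have hunique : ∀ p q : V, p ≠ q → ∀ a b : F, lineIncidence F p a → lineIncidence F q a →
      lineIncidence F p b → lineIncidence F q b → a = b := fun p q hpq a b hpa hqa hpb hqb =>
    Subtype.ext (hF.unique p q hpq a a.2 b b.2 hpa hqa hpb hqb)
  refine ⟨?_, h.two_le, ?_, ‹_›, ?_, hunique, fun a => ?_, fun p => ?_, fun a p hpa => ?_⟩
  · have := h.k_pos
    by_contra! hK₁
    have := Nat.mul_le_mul_left m hK₁
    omega
  · exact Nat.pos_of_mul_pos_left (hT ▸ h.mu_pos)
  · obtain ⟨p⟩ := ‹Nonempty V›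
    obtain ⟨c, hc⟩ := card_pos.1 ((hD p).symm ▸ hm)
    exact ⟨c, (mem_filter.1 hc).1⟩
  · exact (Set.ncard_coe_finset a.1).trans
      (Nat.eq_of_mul_eq_mul_left hm ((hcard a a.2).trans hK.symm))
  · rw [← hD p, ← Set.ncard_coe_finset, ← Set.ncard_image_of_injective _ Subtype.val_injective]
    congr 1
    ext c
    simp [lineIncidence, and_comm]
  · rw [ncard_lines_meeting_eq_ncard_collinear_points hunique hpa]
    have hadj := h.mul_card_neighborFinset_inter_eq (hF.isMaxClique a a.2).prop (hcard a a.2) hpa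
    rw [Nat.eq_of_mul_eq_mul_left hm (hT.trans hadj.symm), ← Set.ncard_coe_finset]
    congr 1
    ext q
    have hadj_iff : G.Adj p q ↔ (pointGraph (lineIncidence F)).Adj p q := by
      rw [← hF.eq_pointGraph]
    rw [coe_inter, SimpleGraph.coe_neighborFinset, Set.mem_inter_iff, and_comm,
      SimpleGraph.mem_neighborSet, hadj_iff]
    exact and_congr_right fun hqa => (and_iff_right fun hpq : p = q => hpa (hpq ▸ hqa)).symm

theorem IsPartialGeometry.T_add_one_eq_or_eq {P L : Type u} [Finite P] [Finite L]
    {I : P → L → Prop} {K R T : ℕ} (h : IsPartialGeometry I K R T)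
    (hK : (K : ℤ) = ℓ - R * T + T + R + 1) (hf : f R (R * T) < ℓ) : T + 1 = R ∨ T = R := by
  by_contra! hne
  have hTR := h.T_le_R
  have hT₂ : T + 2 ≤ R := by omega
  have hK' : (K : ℝ) = ℓ - R * T + T + R + 1 := by exact_mod_cast hK
  have hKle : (K : ℝ) ≤ 2 * R ^ 2 * T := by exact_mod_cast h.dual.R_le hT₂
  have hT₁ : (1 : ℝ) ≤ T := mod_cast h.T_pos
  have hTR' : (T + 2 : ℝ) ≤ R := by exact_mod_cast hT₂
  rw [f, Nat.cast_mul] at hf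
  have : (0 : ℝ) ≤ R * T * (2 * R - 5) :=
    mul_nonneg (mul_nonneg R.cast_nonneg T.cast_nonneg) (by linarith)
  nlinarith

theorem exists_isPartialGeometry [DecidableEq V] (hG : G.IsSRGWith v k ℓ μ) (hc : G.Connected)
    (ht : G ≠ ⊤) (hm : 0 < m)
    (hev : Module.End.HasEigenvalue (toLin' (G.adjMatrix ℝ)) (-(m : ℝ))) (hf : f m μ < ℓ) :
    ∃ (F : Finset (Finset V)) (K T : ℕ), IsPartialGeometry (lineIncidence F) K m T ∧
      G = pointGraph (lineIncidence F) ∧ m * T = μ ∧ (K : ℤ) = ℓ - m * T + T + m + 1 ∧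
      (T + 1 = m ∨ T = m) := by
  have := hc.nonempty
  have h := isSRGWithSmallest_of_hasEigenvalue hG hc ht hm hev hf
  obtain ⟨F, hF, hD⟩ := h.exists_isLineSystem_card_eq hf
  obtain ⟨p⟩ := hc.nonempty
  obtain ⟨c, hcp⟩ := card_pos.1 ((hD p).symm ▸ hm)
  obtain ⟨hcF, hpc⟩ := mem_filter.1 hcp
  have hK := h.mul_card_eq_of_card_lines_eq hF (hD p) hcF hpc
  obtain ⟨T, rfl⟩ := h.dvd_mu (hF.isMaxClique c hcF).prop hK
  have hI := h.isPartialGeometry hF hD hK rfl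
  have hKℓ := h.cast_card_eq hK rfl
  exact ⟨F, #c, T, hI, hF.eq_pointGraph, rfl, hKℓ, hI.T_add_one_eq_or_eq hKℓ hf⟩

end LargeLambda

end SRGBound

theorem theorem1p2 {V : Type*} [Fintype V] [DecidableEq V] (G : SimpleGraph V)
    [DecidableRel G.Adj] (v k l μ m : ℕ) (hG : SRGBound.IsPrimitiveSRG G v k l μ)
    (hm : 0 < m) (hmin : SRGBound.IsSmallestEigenvalue G (-(m : ℝ))) :
    ((μ : ℤ) = (m : ℤ) * ((m : ℤ) - 1) → SRGBound.f m μ < (l : ℝ) →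
      (∃ K R T : ℕ, (T : ℤ) = (R : ℤ) - 1 ∧ SRGBound.IsCollinearityGraph G K R T) ∧
      ∃ n : ℕ, (n : ℤ) = (l : ℤ) - (m : ℤ) * ((m : ℤ) - 3) ∧
        SRGBound.IsLatinSquareGraph G m n) ∧
    ((μ : ℤ) = (m : ℤ) ^ 2 → SRGBound.f m μ < (l : ℝ) →
      (∃ K R T : ℕ, T = R ∧ SRGBound.IsCollinearityGraph G K R T) ∧
      ∃ w : ℕ, (w : ℤ) = (l : ℤ) * ((m : ℤ) - 1)
          - (m : ℤ) * ((m : ℤ) - 1) * ((m : ℤ) - 2) + (m : ℤ) ∧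
        SRGBound.IsBlockGraph G w m 1) ∧
    ((μ : ℤ) ≠ (m : ℤ) * ((m : ℤ) - 1) → (μ : ℤ) ≠ (m : ℤ) ^ 2 →
      (l : ℝ) ≤ SRGBound.f m μ) := by
  have hpg := SRGBound.exists_isPartialGeometry hG.isSRGWith hG.connected hG.ne_top hm hmin.1
  have hm₀ : (m : ℤ) ≠ 0 := mod_cast hm.ne'
  refine ⟨fun hμ hf => ?_, fun hμ hf => ?_, fun hμ₁ hμ₂ => ?_⟩
  · obtain ⟨F, K, T, hI, hGI, rfl, hK, -⟩ := hpg hf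
    have hT : (T : ℤ) = m - 1 := mul_left_cancel₀ hm₀ (by exact_mod_cast hμ)
    rw [hGI]
    exact ⟨⟨K, m, T, hT, hI.isCollinearityGraph⟩, K, by rw [hK, hT]; ring,
      hI.isLatinSquareGraph (by omega)⟩
  · obtain ⟨F, K, T, hI, hGI, rfl, hK, -⟩ := hpg hf
    have hT : (T : ℤ) = m := mul_left_cancel₀ hm₀ (by rw [← sq]; exact_mod_cast hμ)
    obtain rfl : T = m := mod_cast hT
    rw [hGI]
    refine ⟨⟨K, T, T, rfl, hI.isCollinearityGraph⟩, _, ?_, hI.isBlockGraph⟩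
    push_cast [Nat.cast_sub hI.one_lt_K.le, Nat.cast_sub hI.one_lt_R.le]
    rw [hK]
    ring
  · by_contra! hf
    obtain ⟨F, K, T, -, -, rfl, -, rfl | rfl⟩ := hpg hf
    · exact hμ₁ (by push_cast; ring)
    · exact hμ₂ (by push_cast; ring)
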